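/- Let $\Lambda$ be (the vertex set of) a connected graph with graph distance $\mathrm{dist}$, finite or infinite, and write $\mathrm{dist}(X,Y)=\min_{x\in X,\,y\in Y}\mathrm{dist}(x,y)$ and $l_A=\max_{x,y\in A}\mathrm{dist}(x,y)$ for finite sets of sites. Assume that $\Lambda$ is a $d$-dimensional lattice in the sense that, for some constant $C_d$, every finite $A\subseteq\Lambda$ satisfies $|A|\le C_d(l_A+1)^d$. Every site carries a finite-dimensional Hilbert space of dimension at least one. An interaction $\Phi=\sum_A\Phi_A$ is a family of Hermitian operators $\Phi_A$ supported on the finite sets $A\subseteq\Lambda$, and $$\|\Phi\|_\mu=\sup_{j\in\Lambda}\sum_{A\ni j}\|\Phi_A\|\,e^{\mu l_A}.$$ If $\Lambda$ is infinite, Hamiltonians and time evolutions below are those of an arbitrary finite region $\Lambda'\subseteq\Lambda$ (the sum of the terms supported in $\Lambda'$), while the constants, distances and norms $\|\cdot\|_\mu$ are those of all of $\Lambda$; if $\Lambda$ is finite, one may take $\Lambda'=\Lambda$. Local operators $O_X$, $O_Y$ are arbitrary operators supported on finite regions $X$, $Y$ (contained in $\Lambda'$). (a) Lieb–Robinson bound.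 Let $H(t)=\sum_A H_A(t)$, $t\in\mathbb{R}$, be a time-dependent interaction, with each $H_A(t)$ measurable in $t$, such that for every $\mu<\mu^*$ the norm $\|H(t)\|_\mu$ is bounded uniformly in $t$. Let $U(t,t')$ be the time-evolution operator generated by $H(t)$: $i\partial_tU(t,t')=H(t)U(t,t')$, $U(t',t')=1$. Then for all $O_X$, $O_Y$, all $\kappa,\eta>0$ with $\kappa+\eta<\mu^*$ and all $t'\le t$, $$\|[U(t,t')^\dagger O_XU(t,t'),O_Y]\|\le 2\min\{|X|,|Y|\}\,\|O_X\|\,\|O_Y\|\,\exp\Big(-\kappa\Big[\mathrm{dist}(X,Y)-\frac{2C_d\,e^{\eta}}{\kappa}\Big(\frac{d}{e\eta}\Big)^d\int_{t'}^t\|H(s)\|_{\kappa+\eta}\,ds\Big]\Big).$$ (b) Consequence. Let $H=H_0+V$, where $H_0=\sum_jH_{0j}$ is a commuting local Hamiltonian: each Hermitian term $H_{0j}$ is supported on a finite region $R_j\ni j$, all terms commute with one another, the diameters $l_{R_j}$ are at most $l_0$, and $\big|\bigcup_{j':\,R_{j'}\ni j}R_{j'}\big|\le w$ for every site $j$. Let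 $V$ be an interaction and let $\kappa,\eta>0$ with $\|V\|_{\kappa+\eta}<\infty$. Then for all $t\ge0$, with $O_X(t)=e^{iHt}O_Xe^{-iHt}$, $$\|[O_X(t),O_Y]\|\le 2e^{\kappa l_0}\min\{|X|,|Y|\}\,\|O_X\|\,\|O_Y\|\,\exp\Big(-\kappa\Big[\mathrm{dist}(X,Y)-\frac{2wC_d\,e^{\eta}}{\kappa}\Big(\frac{d}{e\eta}\Big)^de^{2(\kappa+\eta)l_0}\,\|V\|_{\kappa+\eta}\,t\Big]\Big),$$ so that the velocity in the bound depends on $H_0$ only through its geometry ($l_0$ and $w$) and not on its strength. -/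

import Mathlib

open scoped Matrix.Norms.L2Operator

noncomputable section

namespace LiebRobinson

variable {V : Type*} [DecidableEq V]

/-- Basis labels of the Hilbert space `⨂_{x ∈ A} ℂ^(q x)` of a finite region `A`, where the site `x`
carries the local Hilbert space `ℂ^(q x)`. -/
abbrev Config (q : V → ℕ) (A : Finset V) : Type _ := (x : A) → Fin (q x)

/-- Operators on the Hilbert space of the finite region `A`, with the operator norm. -/
abbrev LocOp (q : V → ℕ) (A : Finset V) : Type _ := Matrix (Config q A) (Config q A) ℂ

/-- The operator `M ⊗ 1` on the Hilbert space of `Λ`, for `M` an operator on the subregion `A`. -/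
def extend {q : V → ℕ} {A Λ : Finset V} (h : A ⊆ Λ) (M : LocOp q A) : LocOp q Λ :=
  Matrix.of fun σ τ =>
    if ∀ x : Λ, (x : V) ∉ A → σ x = τ x then
      M (fun x => σ ⟨x, h x.2⟩) (fun x => τ ⟨x, h x.2⟩)
    else 0

/-- The diameter `l_A = max_{x, y ∈ A} dist(x, y)` of a finite set of sites, for the graph distance. -/
def diam (G : SimpleGraph V) (A : Finset V) : ℕ :=
  A.sup fun x => A.sup fun y => G.dist x y

/-- The distance `dist(X, Y) = min_{x ∈ X, y ∈ Y} dist(x, y)`. -/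
def setDist (G : SimpleGraph V) (X Y : Finset V) : ℕ :=
  sInf {n : ℕ | ∃ x ∈ X, ∃ y ∈ Y, G.dist x y = n}

/-- A family of local terms `Φ_A`, one for each finite set of sites `A`, where `Φ_A` acts on `A`. -/
abbrev Interaction (q : V → ℕ) : Type _ := (A : Finset V) → LocOp q A

/-- The interaction norm `‖Φ‖_μ = sup_j ∑_{A ∋ j} ‖Φ_A‖ exp (μ l_A)`, possibly infinite. -/
def interactionNorm (G : SimpleGraph V) {q : V → ℕ} (μ : ℝ) (Φ : Interaction q) : ENNReal :=
  ⨆ j : V, ∑' A : {A : Finset V // j ∈ A},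
    ENNReal.ofReal (‖Φ A.1‖ * Real.exp (μ * (diam G A.1 : ℝ)))

/-- The Hamiltonian `∑_{A ⊆ Λ} Φ_A` of the finite region `Λ`. -/
def hamiltonian {q : V → ℕ} (Λ : Finset V) (Φ : Interaction q) : LocOp q Λ :=
  ∑ A : {A : Finset V // A ∈ Λ.powerset}, extend (Finset.mem_powerset.1 A.2) (Φ A.1)

/-- `U(t, t')` is the time-evolution operator generated by `H(t)`:
`i ∂_t U(t, t') = H(t) U(t, t')` and `U(t', t') = 1`. -/
def IsPropagator {q : V → ℕ} {Λ : Finset V} (H : ℝ → LocOp q Λ) (U : ℝ → ℝ → LocOp q Λ) : Prop :=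
  ∀ t' : ℝ, U t' t' = 1 ∧
    ∀ t : ℝ, HasDerivAt (fun s => U s t') (-Complex.I • (H t * U t t')) t

/-- The Heisenberg-picture operator `e^{iHt} O e^{-iHt}`. -/
def heisenberg {q : V → ℕ} {Λ : Finset V} (H O : LocOp q Λ) (t : ℝ) : LocOp q Λ :=
  NormedSpace.exp ((Complex.I * (t : ℂ)) • H) * O * NormedSpace.exp (-(Complex.I * (t : ℂ)) • H)

/-- The sum `∑_j h_j` of the terms with `R_j ⊆ Λ`, where `h_j` acts on the finite region `R_j`. -/
def siteHamiltonian {q : V → ℕ} (Λ : Finset V) (R : V → Finset V) (h : (j : V) → LocOp q (R j)) :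
    LocOp q Λ :=
  ∑ j : Λ, if hj : R j ⊆ Λ then extend hj (h j) else 0

/-- `h_j` and `h_{j'}` commute for all sites `j`, `j'`. -/
def IsCommuting {q : V → ℕ} (R : V → Finset V) (h : (j : V) → LocOp q (R j)) : Prop :=
  ∀ j j' : V,
    Commute (extend (Finset.subset_union_left : R j ⊆ R j ∪ R j') (h j))
      (extend (Finset.subset_union_right : R j' ⊆ R j ∪ R j') (h j'))

end LiebRobinson

end

/-! Let `P` be supported on `Y` and let `O` be supported on `Z`. Differentiating the commutator of
the evolved `O` with `P`, only the terms of the Hamiltonian that meet `Z` enter. The Jacobi identity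
splits the result into a rotation of the commutator, which leaves its norm unchanged, and a
remainder made of commutators of evolved local terms with `P`. These terms, frozen at the current
time, are local operators themselves, so the estimate closes on the family of all local operators.

The iteration is controlled by a positive site weight `w` with `w ≥ 1` on `Y`. If the terms through
a site `x`, each multiplied by the total weight of its region, sum to at most `g t * w x / 2`, then
each Picard step preserves the form `2‖O‖‖P‖ ∑ z ∈ Z, w z` times a function of time, and the
iterates converge to `exp (∫ g)` (`IsLocalEvolution.norm_lie_le`).

For a quasi-local interaction take `w x = exp (-κ dist(x, Y))`. Across a region of diameter `l` the
weight changes by at most `exp (κ l)`, and the number of sites costs a multiple of `exp (η l)`;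
hence the norm with exponent `κ + η` (`isDominated_siteWeight`). Time reversal exchanges `X` and `Y`
and gives the minimum of the cardinalities.

For `H₀ + V` one passes to the interaction picture. Since the terms of `H₀` commute, its evolution
enlarges a support by only one layer of regions, whatever the time and the strength
(`expI_conj_mem_localAlgebra`), so the rotated terms of `V` obey the same abstract bound. -/

noncomputable section

namespace LiebRobinson

/-! ### Operators supported on a region -/

section LocalAlgebra

variable {V : Type*} [DecidableEq V] {q : V → ℕ}

/-- The configuration on `Λ` that agrees with `ρ` on `A` and with `τ` elsewhere. -/
def glue {A Λ : Finset V} (ρ : Config q A) (τ : Config q Λ) : Config q Λ :=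
  fun x => if hx : (x : V) ∈ A then ρ ⟨x, hx⟩ else τ x

theorem glue_of_mem {A Λ : Finset V} (ρ : Config q A) (τ : Config q Λ) {x : Λ} (hx : (x : V) ∈ A) :
    glue ρ τ x = ρ ⟨x, hx⟩ := dif_pos hx

theorem glue_of_notMem {A Λ : Finset V} (ρ : Config q A) (τ : Config q Λ) {x : Λ}
    (hx : (x : V) ∉ A) : glue ρ τ x = τ x := dif_neg hx

theorem extend_apply {A Λ : Finset V} (h : A ⊆ Λ) (M : LocOp q A) (σ τ : Config q Λ) :
    extend h M σ τ = if ∀ x : Λ, (x : V) ∉ A → σ x = τ x then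
      M (fun x => σ ⟨x, h x.2⟩) (fun x => τ ⟨x, h x.2⟩) else 0 := rfl

theorem extend_one {A Λ : Finset V} (h : A ⊆ Λ) : extend h (1 : LocOp q A) = 1 := by
  ext σ τ
  rw [extend_apply, Matrix.one_apply, Matrix.one_apply]
  by_cases hστ : σ = τ
  · subst hστ; simp
  · rw [if_neg hστ]
    split_ifs with h1 h2
    · refine absurd (funext fun x => ?_) hστ
      by_cases hx : (x : V) ∈ A
      · exact congrFun h2 ⟨x, hx⟩
      · exact h1 x hx
    · rfl
    · rfl

/-- An intermediate configuration contributes only if it agrees with `τ` off `A`; these are exactly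
the `glue ρ τ`, one for each `ρ` on `A`. -/
theorem extend_mul {A Λ : Finset V} (h : A ⊆ Λ) (M N : LocOp q A) :
    extend h (M * N) = extend h M * extend h N := by
  ext σ τ
  rw [Matrix.mul_apply, extend_apply]
  split_ifs with hστ
  · rw [Matrix.mul_apply]
    refine Fintype.sum_of_injective (fun ρ : Config q A => glue ρ τ) ?_ _ _ ?_ ?_
    · intro ρ ρ' hρ
      funext x
      have := congrFun hρ ⟨x, h x.2⟩
      simpa only [glue_of_mem ρ τ (x := ⟨x, h x.2⟩) x.2,
        glue_of_mem ρ' τ (x := ⟨x, h x.2⟩) x.2] using this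
    · intro ρ hρ
      rw [extend_apply h N]
      rw [if_neg, mul_zero]
      intro hρτ
      refine hρ ⟨fun x => ρ ⟨x, h x.2⟩, funext fun x => ?_⟩
      by_cases hx : (x : V) ∈ A
      · exact glue_of_mem _ _ hx
      · exact (glue_of_notMem _ _ hx).trans (hρτ x hx).symm
    · intro ρ
      have hg : (fun x : A => glue ρ τ ⟨x, h x.2⟩) = ρ :=
        funext fun x => glue_of_mem ρ τ (x := ⟨x, h x.2⟩) x.2
      rw [extend_apply, extend_apply, if_pos, if_pos, hg]
      · intro x hx; exact glue_of_notMem _ _ hx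
      · intro x hx; exact (hστ x hx).trans (glue_of_notMem _ _ hx).symm
  · refine (Finset.sum_eq_zero fun ρ _ => ?_).symm
    rw [extend_apply, extend_apply]
    split_ifs with h1 h2
    · exact absurd (fun x hx => (h1 x hx).trans (h2 x hx)) hστ
    all_goals simp

theorem extend_add {A Λ : Finset V} (h : A ⊆ Λ) (M N : LocOp q A) :
    extend h (M + N) = extend h M + extend h N := by
  ext σ τ
  simp only [extend_apply, Matrix.add_apply]
  split_ifs <;> simp

theorem extend_smul {A Λ : Finset V} (h : A ⊆ Λ) (c : ℂ) (M : LocOp q A) :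
    extend h (c • M) = c • extend h M := by
  ext σ τ
  simp only [extend_apply, Matrix.smul_apply]
  split_ifs <;> simp

theorem extend_star {A Λ : Finset V} (h : A ⊆ Λ) (M : LocOp q A) :
    extend h (star M) = star (extend h M) := by
  ext σ τ
  simp only [extend_apply, Matrix.star_apply]
  simp only [eq_comm (a := σ _)]
  split_ifs <;> simp

/-- `M ↦ M ⊗ 1` as a morphism of star algebras. -/
def extendHom {A Λ : Finset V} (h : A ⊆ Λ) : LocOp q A →⋆ₐ[ℂ] LocOp q Λ where
  toFun := extend h
  map_one' := extend_one h
  map_mul' := extend_mul h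
  map_zero' := by simpa using extend_smul h 0 (0 : LocOp q A)
  map_add' := extend_add h
  commutes' c := by rw [Algebra.algebraMap_eq_smul_one, extend_smul, extend_one,
    Algebra.algebraMap_eq_smul_one]
  map_star' := extend_star h

theorem extendHom_apply {A Λ : Finset V} (h : A ⊆ Λ) (M : LocOp q A) :
    extendHom h M = extend h M := rfl

/-- Morphisms of C*-algebras are contractive. -/
theorem norm_extend_le {A Λ : Finset V} (h : A ⊆ Λ) (M : LocOp q A) : ‖extend h M‖ ≤ ‖M‖ :=
  NonUnitalStarAlgHom.norm_apply_le (extendHom h) M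

theorem extend_extend {A B Λ : Finset V} (hAB : A ⊆ B) (hB : B ⊆ Λ) (M : LocOp q A) :
    extend hB (extend hAB M) = extend (hAB.trans hB) M := by
  ext σ τ
  simp only [extend_apply]
  by_cases h1 : ∀ x : Λ, (x : V) ∉ A → σ x = τ x
  · rw [if_pos h1, if_pos, if_pos]
    · exact fun x hx => h1 _ hx
    · exact fun x hx => h1 x fun hxA => hx (hAB hxA)
  · rw [if_neg h1]
    split_ifs with h2 h3
    · refine absurd (fun x hx => ?_) h1
      by_cases hxB : (x : V) ∈ B
      · exact h3 ⟨x, hxB⟩ hx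
      · exact h2 x hxB
    · rfl
    · rfl

theorem extend_rfl {Λ : Finset V} (M : LocOp q Λ) : extend (Finset.Subset.refl Λ) M = M := by
  ext σ τ
  rw [extend_apply, if_pos]
  exact fun x hx => absurd x.2 hx

/-- A single intermediate configuration survives: `τ` on `A` and `σ` elsewhere. The resulting
formula is symmetric in the two factors, which is why disjoint supports commute. -/
theorem extend_mul_extend_apply {A B Λ : Finset V} (hA : A ⊆ Λ) (hB : B ⊆ Λ) (hAB : Disjoint A B)
    (M : LocOp q A) (N : LocOp q B) (σ τ : Config q Λ) :
    (extend hA M * extend hB N) σ τ =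
      if ∀ x : Λ, (x : V) ∉ A → (x : V) ∉ B → σ x = τ x then
        M (fun x => σ ⟨x, hA x.2⟩) (fun x => τ ⟨x, hA x.2⟩) *
          N (fun x => σ ⟨x, hB x.2⟩) (fun x => τ ⟨x, hB x.2⟩) else 0 := by
  rw [Matrix.mul_apply, Finset.sum_eq_single (glue (fun x : A => τ ⟨x, hA x.2⟩) σ)]
  · rw [extend_apply, extend_apply, if_pos fun x hx => (glue_of_notMem _ _ hx).symm]
    have h1 : (fun x : A => glue (fun x : A => τ ⟨x, hA x.2⟩) σ ⟨x, hA x.2⟩) =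
        fun x : A => τ ⟨x, hA x.2⟩ :=
      funext fun x => glue_of_mem _ σ (x := ⟨x, hA x.2⟩) x.2
    have h2 : (fun x : B => glue (fun x : A => τ ⟨x, hA x.2⟩) σ ⟨x, hB x.2⟩) =
        fun x : B => σ ⟨x, hB x.2⟩ :=
      funext fun x => glue_of_notMem _ σ (x := ⟨x, hB x.2⟩)
        (Finset.disjoint_right.1 hAB x.2)
    rw [h1, h2, mul_ite, mul_zero]
    refine if_congr ⟨fun H x hxA hxB => ?_, fun H x hxB => ?_⟩ rfl rfl
    · rw [← H x hxB, glue_of_notMem _ _ hxA]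
    · by_cases hxA : (x : V) ∈ A
      · exact glue_of_mem _ _ hxA
      · exact (glue_of_notMem _ _ hxA).trans (H x hxA hxB)
  · intro ρ _ hρ
    rw [extend_apply, extend_apply]
    split_ifs with h1 h2
    · refine absurd (funext fun x => ?_) hρ
      by_cases hxA : (x : V) ∈ A
      · rw [glue_of_mem _ _ hxA]
        exact h2 x (Finset.disjoint_left.1 hAB hxA)
      · rw [glue_of_notMem _ _ hxA, h1 x hxA]
    all_goals simp
  · simp

theorem commute_extend {A B Λ : Finset V} (hA : A ⊆ Λ) (hB : B ⊆ Λ) (hAB : Disjoint A B)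
    (M : LocOp q A) (N : LocOp q B) : Commute (extend hA M) (extend hB N) := by
  ext σ τ
  rw [extend_mul_extend_apply hA hB hAB, extend_mul_extend_apply hB hA hAB.symm]
  exact if_congr ⟨fun H x h1 h2 => H x h2 h1, fun H x h1 h2 => H x h2 h1⟩ (mul_comm _ _) rfl

/-- The operators on the Hilbert space of `Λ` that are supported on `A ∩ Λ`. -/
def localAlgebra (q : V → ℕ) (Λ A : Finset V) : StarSubalgebra ℂ (LocOp q Λ) :=
  (extendHom (Finset.inter_subset_right : A ∩ Λ ⊆ Λ)).range

theorem extend_mem_localAlgebra {A B Λ : Finset V} (hA : A ⊆ Λ) (hAB : A ⊆ B) (M : LocOp q A) :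
    extend hA M ∈ localAlgebra q Λ B :=
  ⟨extend (Finset.subset_inter hAB hA) M, extend_extend _ Finset.inter_subset_right _⟩

theorem mem_localAlgebra_self {Λ : Finset V} (O : LocOp q Λ) : O ∈ localAlgebra q Λ Λ := by
  simpa only [extend_rfl] using
    extend_mem_localAlgebra (Finset.Subset.refl Λ) (Finset.Subset.refl Λ) O

theorem localAlgebra_mono {Λ A B : Finset V} (hAB : A ⊆ B) :
    localAlgebra q Λ A ≤ localAlgebra q Λ B := by
  rintro _ ⟨M, rfl⟩
  exact extend_mem_localAlgebra Finset.inter_subset_right (Finset.inter_subset_left.trans hAB) M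

theorem commute_of_disjoint {Λ A B : Finset V} (hAB : Disjoint A B) {M N : LocOp q Λ}
    (hM : M ∈ localAlgebra q Λ A) (hN : N ∈ localAlgebra q Λ B) : Commute M N := by
  obtain ⟨M, rfl⟩ := hM
  obtain ⟨N, rfl⟩ := hN
  exact commute_extend Finset.inter_subset_right Finset.inter_subset_right (hAB.mono Finset.inter_subset_left Finset.inter_subset_left) M N

theorem isClosed_localAlgebra (Λ A : Finset V) :
    IsClosed (localAlgebra q Λ A : Set (LocOp q Λ)) :=
  Submodule.closed_of_finiteDimensional
    (Subalgebra.toSubmodule (localAlgebra q Λ A).toSubalgebra)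

theorem exp_mem_localAlgebra {Λ A : Finset V} {M : LocOp q Λ} (hM : M ∈ localAlgebra q Λ A) :
    NormedSpace.exp M ∈ localAlgebra q Λ A :=
  NormedSpace.exp_mem (isClosed_localAlgebra Λ A) hM

end LocalAlgebra

/-! ### Differential inequalities and Picard polynomials -/

section AnalyticTools

open MeasureTheory Set

/-- The growth rate will be only measurable in time, so derivatives are available almost everywhere;
absolute continuity still recovers the increment as an integral. -/
theorem le_of_ae_hasDerivAt_nonpos {f : ℝ → ℝ} {a b : ℝ} (hab : a ≤ b)
    (hf : AbsolutelyContinuousOnInterval f a b)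
    (hf' : ∀ᵐ t, t ∈ Icc a b → ∀ c, HasDerivAt f c t → c ≤ 0) : f b ≤ f a := by
  have h1 := hf.integral_deriv_eq_sub
  have h2 : 0 ≤ ∫ t in a..b, -deriv f t := by
    refine intervalIntegral.integral_nonneg_of_ae_restrict hab ?_
    rw [Filter.EventuallyLE, ae_restrict_iff' measurableSet_Icc]
    filter_upwards [hf', hf.ae_differentiableAt] with t h h' ht
    rw [uIcc_of_le hab] at h'
    simpa using h ht _ (h' ht).hasDerivAt
  rw [intervalIntegral.integral_neg] at h2
  linarith

theorem absolutelyContinuous_pow {f : ℝ → ℝ} {a b : ℝ}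
    (hf : AbsolutelyContinuousOnInterval f a b) (n : ℕ) :
    AbsolutelyContinuousOnInterval (fun t => f t ^ n) a b := by
  induction n with
  | zero =>
    simp only [pow_zero]
    exact ((LipschitzWith.const (1 : ℝ)).lipschitzOnWith).absolutelyContinuousOnInterval
  | succ n ih =>
    simp only [pow_succ]
    exact ih.smul hf

/-- The Taylor polynomial of degree `n` of the exponential, with `c` in place of the last
numerator. -/
def picardPoly (c : ℝ) (n : ℕ) (x : ℝ) : ℝ :=
  (∑ k ∈ Finset.range n, x ^ k / k.factorial) + c * (x ^ n / n.factorial)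

theorem hasDerivAt_pow_div_factorial (n : ℕ) (x : ℝ) :
    HasDerivAt (fun y : ℝ => y ^ (n + 1) / (n + 1).factorial) (x ^ n / n.factorial) x := by
  have h := (hasDerivAt_pow (n + 1) x).div_const ((n + 1).factorial : ℝ)
  refine h.congr_deriv ?_
  rw [Nat.factorial_succ]
  push_cast
  have : (n.factorial : ℝ) ≠ 0 := by positivity
  have : (n : ℝ) + 1 ≠ 0 := by positivity
  field_simp

theorem hasDerivAt_sum_pow_div_factorial (n : ℕ) (x : ℝ) :
    HasDerivAt (fun y : ℝ => ∑ k ∈ Finset.range (n + 1), y ^ k / k.factorial)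
      (∑ k ∈ Finset.range n, x ^ k / k.factorial) x := by
  induction n with
  | zero => simpa using hasDerivAt_const x (1 : ℝ)
  | succ n ih =>
    rw [Finset.sum_range_succ]
    simp only [Finset.sum_range_succ _ (n + 1)]
    exact ih.add (hasDerivAt_pow_div_factorial n x)

/-- Integration raises the degree by one, so these polynomials are the Picard iterates that start
from the constant `c`. -/
theorem hasDerivAt_picardPoly (c : ℝ) (n : ℕ) (x : ℝ) :
    HasDerivAt (picardPoly c (n + 1)) (picardPoly c n x) x :=
  (hasDerivAt_sum_pow_div_factorial n x).add ((hasDerivAt_pow_div_factorial n x).const_mul c)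

theorem picardPoly_succ_zero (c : ℝ) (n : ℕ) : picardPoly c (n + 1) 0 = 1 := by
  simp [picardPoly, Finset.sum_range_succ']

theorem absolutelyContinuous_picardPoly {f : ℝ → ℝ} {a b : ℝ}
    (hf : AbsolutelyContinuousOnInterval f a b) (c : ℝ) (n : ℕ) :
    AbsolutelyContinuousOnInterval (fun t => picardPoly c n (f t)) a b := by
  have hk : ∀ k : ℕ, AbsolutelyContinuousOnInterval (fun t => f t ^ k / k.factorial) a b := by
    intro k
    simpa only [div_eq_inv_mul] using
      (absolutelyContinuous_pow hf k).const_mul ((k.factorial : ℝ)⁻¹)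
  have hs : AbsolutelyContinuousOnInterval
      (fun t => ∑ k ∈ Finset.range n, f t ^ k / k.factorial) a b := by
    induction n with
    | zero =>
      simp only [Finset.range_zero, Finset.sum_empty]
      exact ((LipschitzWith.const (0 : ℝ)).lipschitzOnWith).absolutelyContinuousOnInterval
    | succ n ih =>
      simp only [Finset.sum_range_succ]
      exact ih.add (hk n)
  exact hs.add ((hk n).const_mul c)

/-- The term carrying the crude constant `c` vanishes in the limit because `x ^ n / n!` tends to
zero. -/
theorem le_mul_exp_of_forall_picardPoly {y p c x : ℝ} (hp : 0 ≤ p) (hx : 0 ≤ x)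
    (h : ∀ n, y ≤ p * picardPoly c n x) : y ≤ p * Real.exp x := by
  have h1 : Filter.Tendsto (fun n : ℕ => p * (Real.exp x + c * (x ^ n / n.factorial)))
      Filter.atTop (nhds (p * (Real.exp x + c * 0))) :=
    ((tendsto_const_nhds).add
      ((FloorSemiring.tendsto_pow_div_factorial_atTop x).const_mul c)).const_mul p
  rw [mul_zero, add_zero] at h1
  refine ge_of_tendsto' h1 fun n => (h n).trans ?_
  refine mul_le_mul_of_nonneg_left ?_ hp
  exact add_le_add (Real.sum_le_exp_of_nonneg hx n) le_rfl

section CStar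

variable {𝒜 : Type*} [CStarAlgebra 𝒜]

theorem norm_exp_conj {x : 𝒜} (hx : x ∈ skewAdjoint 𝒜) (y : 𝒜) :
    ‖NormedSpace.exp (-x) * y * NormedSpace.exp x‖ = ‖y‖ := by
  let := NormedAlgebra.restrictScalars ℚ ℂ 𝒜
  rw [CStarRing.norm_mul_mem_unitary _ (NormedSpace.exp_mem_unitary_of_mem_skewAdjoint hx),
    CStarRing.norm_mem_unitary_mul _
      (NormedSpace.exp_mem_unitary_of_mem_skewAdjoint (neg_mem hx))]

theorem I_smul_mem_skewAdjoint {k : 𝒜} (hk : IsSelfAdjoint k) (r : ℝ) :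
    (Complex.I * (r : ℂ)) • k ∈ skewAdjoint 𝒜 := by
  rw [skewAdjoint.mem_iff, star_smul, hk.star_eq]
  simp

/-- The norm grows at most at the rate of the part of the derivative that is not generated by a
one-parameter unitary group. -/
theorem deriv_norm_le {f : ℝ → 𝒜} {x r : 𝒜} {t c : ℝ} (hx : x ∈ skewAdjoint 𝒜)
    (hf : HasDerivAt f (x * f t - f t * x + r) t)
    (hc : HasDerivAt (fun s => ‖f s‖) c t) : c ≤ ‖r‖ := by
  have he : ∀ y : 𝒜, HasDerivAt (fun s : ℝ => NormedSpace.exp ((s - t) • y)) y t := by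
    intro y
    have h := hasDerivAt_exp_smul_const (𝕂 := ℝ) y (t - t)
    simpa using h.comp_sub_const t t
  -- Conjugating by the group generated by `x`, frozen at time `t`, cancels the commutator in the
  -- derivative at `t` and preserves the norm.
  set u : ℝ → 𝒜 := fun s => NormedSpace.exp ((s - t) • (-x)) * f s *
    NormedSpace.exp ((s - t) • x) with hu
  have hu' : HasDerivAt u r t := by
    have h := ((he (-x)).mul hf).mul (he x)
    refine h.congr_deriv ?_
    simp only [sub_self, zero_smul, NormedSpace.exp_zero, Pi.mul_apply, one_mul, mul_one]
    noncomm_ring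
  have hnorm : ∀ s, ‖u s‖ = ‖f s‖ := by
    intro s
    have h := norm_exp_conj (skewAdjoint.smul_mem (s - t) hx) (f s)
    rwa [← smul_neg] at h
  have h1 : Filter.Tendsto (fun s => |slope (fun s => ‖f s‖) t s|) (nhdsWithin t {t}ᶜ)
      (nhds |c|) := hc.tendsto_slope.abs
  have h2 : Filter.Tendsto (fun s => ‖slope u t s‖) (nhdsWithin t {t}ᶜ) (nhds ‖r‖) :=
    hu'.tendsto_slope.norm
  -- By the reverse triangle inequality, slopes of the norm are bounded by norms of slopes.
  refine (le_abs_self c).trans (le_of_tendsto_of_tendsto' h1 h2 fun s => ?_)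
  rw [slope_def_module, slope_def_module, norm_smul, smul_eq_mul, abs_mul, ← hnorm, ← hnorm,
    Real.norm_eq_abs]
  exact mul_le_mul_of_nonneg_left (abs_norm_sub_norm_le _ _) (abs_nonneg _)

theorem norm_lie_le_two_mul (x y : 𝒜) : ‖⁅x, y⁆‖ ≤ 2 * ‖x‖ * ‖y‖ := by
  rw [Ring.lie_def]
  calc ‖x * y - y * x‖ ≤ ‖x * y‖ + ‖y * x‖ := norm_sub_le _ _
    _ ≤ ‖x‖ * ‖y‖ + ‖y‖ * ‖x‖ := add_le_add (norm_mul_le _ _) (norm_mul_le _ _)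
    _ = 2 * ‖x‖ * ‖y‖ := by ring

theorem norm_star_mul_mul {u : 𝒜} (hu : u ∈ unitary 𝒜) (x : 𝒜) : ‖star u * x * u‖ = ‖x‖ := by
  rw [CStarRing.norm_mul_mem_unitary _ hu, CStarRing.norm_mem_unitary_mul _
    (Unitary.star_mem hu)]

end CStar

end AnalyticTools

/-! ### The abstract bound with site weights -/

section AbstractBound

open MeasureTheory Set

section Evolution

variable {n : Type*} [Fintype n] [DecidableEq n] {H U : ℝ → Matrix n n ℂ} {a : ℝ}

theorem hasDerivAt_star_mul {U₁ U₂ : ℝ → Matrix n n ℂ} (hH : ∀ t, IsSelfAdjoint (H t))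
    (h₁ : ∀ t, HasDerivAt U₁ (-Complex.I • (H t * U₁ t)) t)
    (h₂ : ∀ t, HasDerivAt U₂ (-Complex.I • (H t * U₂ t)) t) (t : ℝ) :
    HasDerivAt (fun s => star (U₁ s) * U₂ s) 0 t := by
  refine ((h₁ t).star.mul (h₂ t)).congr_deriv ?_
  simp only [star_smul, star_mul, (hH t).star_eq, star_neg, Complex.star_def, Complex.conj_I,
    neg_neg, smul_mul_assoc, mul_smul_comm, mul_assoc, neg_smul, mul_neg, add_neg_cancel]

/-- Inner products of solutions are conserved. This gives both unitarity and the adjoint relation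
between forward and backward propagators. -/
theorem star_mul_eq_star_mul {U₁ U₂ : ℝ → Matrix n n ℂ} (hH : ∀ t, IsSelfAdjoint (H t))
    (h₁ : ∀ t, HasDerivAt U₁ (-Complex.I • (H t * U₁ t)) t)
    (h₂ : ∀ t, HasDerivAt U₂ (-Complex.I • (H t * U₂ t)) t) (s t : ℝ) :
    star (U₁ s) * U₂ s = star (U₁ t) * U₂ t :=
  is_const_of_deriv_eq_zero (fun t => (hasDerivAt_star_mul hH h₁ h₂ t).differentiableAt)
    (fun t => (hasDerivAt_star_mul hH h₁ h₂ t).deriv) s t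

theorem mem_unitary_of_hasDerivAt (hH : ∀ t, IsSelfAdjoint (H t)) (hU₀ : U a = 1)
    (hU : ∀ t, HasDerivAt U (-Complex.I • (H t * U t)) t) (t : ℝ) :
    U t ∈ unitary (Matrix n n ℂ) := by
  have h : star (U t) * U t = 1 := by
    rw [star_mul_eq_star_mul hH hU hU t a, hU₀, star_one, one_mul]
  exact Unitary.mem_iff.2 ⟨h, mul_eq_one_comm.1 h⟩

theorem hasDerivAt_star_mul_mul (hH : ∀ t, IsSelfAdjoint (H t))
    (hU : ∀ t, HasDerivAt U (-Complex.I • (H t * U t)) t) (O : Matrix n n ℂ) (t : ℝ) :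
    HasDerivAt (fun s => star (U s) * O * U s)
      (Complex.I • (star (U t) * (H t * O - O * H t) * U t)) t := by
  refine (((hU t).star.mul_const O).mul (hU t)).congr_deriv ?_
  simp only [star_smul, star_mul, (hH t).star_eq, star_neg, Complex.star_def, Complex.conj_I,
    neg_neg, smul_mul_assoc, mul_smul_comm, neg_smul, mul_neg, ← sub_eq_add_neg, ← smul_sub]
  congr 1
  noncomm_ring

end Evolution

variable {V : Type*} [DecidableEq V] {q : V → ℕ} {Λ : Finset V} {ι : Type*} [Fintype ι]
  {B : ι → Finset V} {K : ι → ℝ → LocOp q Λ} {U : ℝ → LocOp q Λ} {a : ℝ}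

/-- `U` is the evolution from time `a` on generated by the sum of the self-adjoint terms `K i t`,
each supported on the region `B i ⊆ Λ`. -/
structure IsLocalEvolution (B : ι → Finset V) (K : ι → ℝ → LocOp q Λ) (U : ℝ → LocOp q Λ)
    (a : ℝ) : Prop where
  subset : ∀ i, B i ⊆ Λ
  isSelfAdjoint : ∀ i t, IsSelfAdjoint (K i t)
  mem : ∀ i t, K i t ∈ localAlgebra q Λ (B i)
  init : U a = 1
  hasDerivAt : ∀ t, HasDerivAt U (-Complex.I • ((∑ i, K i t) * U t)) t

namespace IsLocalEvolution

theorem isSelfAdjoint_sum (h : IsLocalEvolution B K U a) (s : Finset ι) (t : ℝ) :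
    IsSelfAdjoint (∑ i ∈ s, K i t) :=
  _root_.isSelfAdjoint_sum s fun i _ => h.isSelfAdjoint i t

theorem mem_unitary (h : IsLocalEvolution B K U a) (t : ℝ) : U t ∈ unitary (LocOp q Λ) :=
  mem_unitary_of_hasDerivAt (h.isSelfAdjoint_sum Finset.univ) h.init h.hasDerivAt t

/-- The sum of the terms that may fail to commute with an operator supported on `Z`. -/
def boundary (B : ι → Finset V) (K : ι → ℝ → LocOp q Λ) (Z : Finset V) (t : ℝ) : LocOp q Λ :=
  ∑ i with ¬Disjoint (B i) Z, K i t

theorem hasDerivAt_evolved (h : IsLocalEvolution B K U a) {Z : Finset V} {O : LocOp q Λ}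
    (hO : O ∈ localAlgebra q Λ Z) (t : ℝ) :
    HasDerivAt (fun s => star (U s) * O * U s)
      (Complex.I • ⁅star (U t) * boundary B K Z t * U t, star (U t) * O * U t⁆) t := by
  refine (hasDerivAt_star_mul_mul (h.isSelfAdjoint_sum Finset.univ) h.hasDerivAt O t).congr_deriv ?_
  have hcomm : Commute (∑ i with Disjoint (B i) Z, K i t) O :=
    Commute.sum_left _ _ _ fun i hi =>
      commute_of_disjoint (Finset.mem_filter.1 hi).2 (h.mem i t) hO
  have hsum : ∑ i, K i t = (∑ i with Disjoint (B i) Z, K i t) + boundary B K Z t :=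
    (Finset.sum_filter_add_sum_filter_not _ _ _).symm
  have hu : U t * star (U t) = 1 := (Unitary.mem_iff.1 (h.mem_unitary t)).2
  have hmul : ∀ x y : LocOp q Λ,
      star (U t) * x * U t * (star (U t) * y * U t) = star (U t) * (x * y) * U t := by
    intro x y
    calc _ = star (U t) * x * (U t * star (U t)) * y * U t := by noncomm_ring
      _ = _ := by rw [hu]; noncomm_ring
  rw [Ring.lie_def, hmul, hmul, hsum, add_mul, mul_add, hcomm.eq]
  congr 1
  noncomm_ring

theorem hasDerivAt_lie_evolved (h : IsLocalEvolution B K U a) {Z : Finset V} {O : LocOp q Λ}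
    (hO : O ∈ localAlgebra q Λ Z) (P : LocOp q Λ) (t : ℝ) :
    HasDerivAt (fun s => ⁅star (U s) * O * U s, P⁆)
      (⁅Complex.I • ⁅star (U t) * boundary B K Z t * U t, star (U t) * O * U t⁆, P⁆) t := by
  simp only [Ring.lie_def _ P]
  exact ((h.hasDerivAt_evolved hO t).mul_const P).sub ((h.hasDerivAt_evolved hO t).const_mul P)

/-- The Jacobi identity: a commutator with a skew-adjoint element when `k` is self-adjoint, plus a
remainder that sees `p` only through `⁅k, p⁆`. -/
theorem lie_I_smul_lie {𝒜 : Type*} [CStarAlgebra 𝒜] (k o p : 𝒜) :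
    ⁅Complex.I • ⁅k, o⁆, p⁆ =
      ((Complex.I * (1 : ℝ)) • k) * ⁅o, p⁆ - ⁅o, p⁆ * ((Complex.I * (1 : ℝ)) • k) +
        -(Complex.I • ⁅o, ⁅k, p⁆⁆) := by
  simp only [Ring.lie_def, Complex.ofReal_one, mul_one, smul_mul_assoc, mul_smul_comm, ← smul_sub,
    ← smul_neg, ← smul_add]
  congr 1
  noncomm_ring

/-- The rotation part drops out. Each summand on the right has the shape of the left side, with `K i
t` in place of `O`, which permits iteration. -/
theorem deriv_norm_lie_le (h : IsLocalEvolution B K U a) {Z : Finset V} {O : LocOp q Λ}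
    (hO : O ∈ localAlgebra q Λ Z) (P : LocOp q Λ) {t c : ℝ}
    (hc : HasDerivAt (fun s => ‖⁅star (U s) * O * U s, P⁆‖) c t) :
    c ≤ 2 * ‖O‖ * ∑ i with ¬Disjoint (B i) Z, ‖⁅star (U t) * K i t * U t, P⁆‖ := by
  have hk : IsSelfAdjoint (star (U t) * boundary B K Z t * U t) := by
    have hc := (h.isSelfAdjoint_sum {i | ¬Disjoint (B i) Z} t).conjugate (star (U t))
    rwa [star_star] at hc
  have hd := h.hasDerivAt_lie_evolved hO P t
  rw [lie_I_smul_lie] at hd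
  refine (deriv_norm_le (I_smul_mem_skewAdjoint hk 1) hd hc).trans ?_
  rw [norm_neg, norm_smul, Complex.norm_I, one_mul]
  refine (norm_lie_le_two_mul _ _).trans ?_
  rw [norm_star_mul_mul (h.mem_unitary t)]
  refine mul_le_mul_of_nonneg_left ?_ (by positivity)
  rw [boundary, Finset.mul_sum, Finset.sum_mul]
  have : ⁅∑ i with ¬Disjoint (B i) Z, star (U t) * K i t * U t, P⁆ =
      ∑ i with ¬Disjoint (B i) Z, ⁅star (U t) * K i t * U t, P⁆ := by
    simp only [Ring.lie_def, Finset.sum_mul, Finset.mul_sum, Finset.sum_sub_distrib]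
  rw [this]
  exact norm_sum_le _ _

/-- The terms `K i t` are dominated by the rate `g t`, with respect to the site weight `w`. -/
def IsDominated (B : ι → Finset V) (K : ι → ℝ → LocOp q Λ) (w : V → ℝ) (g : ℝ → ℝ) : Prop :=
  ∀ x ∈ Λ, ∀ t, 2 * ∑ i with x ∈ B i, ‖K i t‖ * ∑ b ∈ B i, w b ≤ g t * w x

variable {w : V → ℝ} {g : ℝ → ℝ}

theorem IsDominated.norm_le (hd : IsDominated B K w g) (hw : ∀ x, 0 < w x) {i : ι} {x : V}
    (hx : x ∈ Λ) (hi : x ∈ B i) (t : ℝ) : ‖K i t‖ ≤ g t := by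
  have h1 : ‖K i t‖ * w x ≤ ∑ i with x ∈ B i, ‖K i t‖ * ∑ b ∈ B i, w b := by
    refine le_trans ?_ (Finset.single_le_sum
      (f := fun i => ‖K i t‖ * ∑ b ∈ B i, w b) (fun i _ => ?_)
      (Finset.mem_filter.2 ⟨Finset.mem_univ i, hi⟩))
    · exact mul_le_mul_of_nonneg_left
        (Finset.single_le_sum (fun b _ => (hw b).le) hi) (norm_nonneg _)
    · exact mul_nonneg (norm_nonneg _) (Finset.sum_nonneg fun b _ => (hw b).le)
  have h2 := hd x hx t
  have h3 : 0 ≤ ‖K i t‖ * w x := mul_nonneg (norm_nonneg _) (hw x).le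
  exact le_of_mul_le_mul_right (by linarith) (hw x)

/-- A region that meets `Z` is counted at least once when the domination inequality is summed over
the sites of `Z`. -/
theorem IsDominated.sum_boundary_le (hd : IsDominated B K w g) (hw : ∀ x, 0 < w x)
    {Z : Finset V} (hZ : Z ⊆ Λ) (t : ℝ) :
    2 * ∑ i with ¬Disjoint (B i) Z, ‖K i t‖ * ∑ b ∈ B i, w b ≤ g t * ∑ z ∈ Z, w z := by
  have hc : ∀ i, 0 ≤ ‖K i t‖ * ∑ b ∈ B i, w b := fun i =>
    mul_nonneg (norm_nonneg _) (Finset.sum_nonneg fun b _ => (hw b).le)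
  have h1 : ∑ i with ¬Disjoint (B i) Z, ‖K i t‖ * ∑ b ∈ B i, w b ≤
      ∑ z ∈ Z, ∑ i with z ∈ B i, ‖K i t‖ * ∑ b ∈ B i, w b := by
    simp only [Finset.sum_filter]
    rw [Finset.sum_comm]
    refine Finset.sum_le_sum fun i _ => ?_
    by_cases hi : ¬Disjoint (B i) Z
    · rw [if_pos hi]
      obtain ⟨z, hzB, hzZ⟩ := Finset.not_disjoint_iff.1 hi
      refine le_trans ?_ (Finset.single_le_sum
        (f := fun z => if z ∈ B i then ‖K i t‖ * ∑ b ∈ B i, w b else 0) (fun z _ => ?_) hzZ)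
      · exact (if_pos hzB).ge
      · split_ifs
        exacts [hc i, le_rfl]
    · rw [if_neg hi]
      refine Finset.sum_nonneg fun z _ => ?_
      split_ifs
      exacts [hc i, le_rfl]
  calc _ ≤ 2 * ∑ z ∈ Z, ∑ i with z ∈ B i, ‖K i t‖ * ∑ b ∈ B i, w b := by linarith
    _ ≤ _ := by
      rw [Finset.mul_sum, Finset.mul_sum]
      exact Finset.sum_le_sum fun z hz => hd z (hZ hz) t

/-- Supplies the absolute continuity of the commutator norm. Domination does not control terms with
empty support, but these meet no `Z` and are absent from `boundary`. -/
theorem exists_lipschitzWith (h : IsLocalEvolution B K U a) (hw : ∀ x, 0 < w x)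
    (hd : IsDominated B K w g) {c : ℝ} (hg : ∀ t, g t ≤ c) {Z : Finset V} (hZ : Z ⊆ Λ)
    {O : LocOp q Λ} (hO : O ∈ localAlgebra q Λ Z) (P : LocOp q Λ) :
    ∃ C, LipschitzWith C fun s => ‖⁅star (U s) * O * U s, P⁆‖ := by
  have hk : ∀ t, ‖boundary B K Z t‖ ≤ Fintype.card ι * |c| := by
    intro t
    refine (norm_sum_le _ _).trans ((Finset.sum_le_card_nsmul _ _ |c| fun i hi => ?_).trans ?_)
    · obtain ⟨z, hzB, hzZ⟩ := Finset.not_disjoint_iff.1 (Finset.mem_filter.1 hi).2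
      exact ((hd.norm_le hw (hZ hzZ) hzB t).trans (hg t)).trans (le_abs_self c)
    · rw [nsmul_eq_mul]
      exact mul_le_mul_of_nonneg_right (by exact_mod_cast Finset.card_le_univ _) (abs_nonneg c)
  have hL : LipschitzWith (Real.toNNReal (2 * (2 * (Fintype.card ι * |c|) * ‖O‖) * ‖P‖))
      fun s => ⁅star (U s) * O * U s, P⁆ := by
    refine lipschitzWith_of_nnnorm_deriv_le (𝕜 := ℝ)
      (fun t => (h.hasDerivAt_lie_evolved hO P t).differentiableAt) fun t => ?_
    rw [(h.hasDerivAt_lie_evolved hO P t).deriv, ← NNReal.coe_le_coe,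
      Real.coe_toNNReal _ (by positivity), coe_nnnorm]
    refine (norm_lie_le_two_mul _ _).trans ?_
    rw [norm_smul, Complex.norm_I, one_mul]
    have h1 := norm_lie_le_two_mul (star (U t) * boundary B K Z t * U t) (star (U t) * O * U t)
    rw [norm_star_mul_mul (h.mem_unitary t), norm_star_mul_mul (h.mem_unitary t)] at h1
    have h2 := hk t
    gcongr
    exact h1.trans (by gcongr)
  exact ⟨_, lipschitzWith_one_norm.comp hL⟩

/-- One Picard step: a bound `D` valid for all local operators is inserted for the terms `K i t`,
and integration yields `E`. -/
theorem norm_lie_le_of_le (h : IsLocalEvolution B K U a) (hw : ∀ x, 0 < w x)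
    (hd : IsDominated B K w g) {c : ℝ} (hg : ∀ t, g t ≤ c)
    {Y : Finset V} (hwY : ∀ y ∈ Y, 1 ≤ w y) {P : LocOp q Λ} (hP : P ∈ localAlgebra q Λ Y)
    {T : ℝ} {D E : ℝ → ℝ} (hD₀ : ∀ t ∈ Icc a T, 0 ≤ D t)
    (hD : ∀ Z ⊆ Λ, ∀ O ∈ localAlgebra q Λ Z, ∀ t ∈ Icc a T,
      ‖⁅star (U t) * O * U t, P⁆‖ ≤ 2 * ‖O‖ * ‖P‖ * (∑ z ∈ Z, w z) * D t)
    (hEa : E a = 1) (hE : ∀ t ∈ Icc a T, AbsolutelyContinuousOnInterval E a t)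
    (hE' : ∀ᵐ t, t ∈ Icc a T → HasDerivAt E (g t * D t) t)
    {Z : Finset V} (hZ : Z ⊆ Λ) {O : LocOp q Λ} (hO : O ∈ localAlgebra q Λ Z)
    {t : ℝ} (ht : t ∈ Icc a T) :
    ‖⁅star (U t) * O * U t, P⁆‖ ≤ 2 * ‖O‖ * ‖P‖ * (∑ z ∈ Z, w z) * E t := by
  have hwZ : 0 ≤ ∑ z ∈ Z, w z := Finset.sum_nonneg fun z _ => (hw z).le
  set p := 2 * ‖O‖ * ‖P‖ * (∑ z ∈ Z, w z) with hp
  have hp0 : 0 ≤ p := by positivity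
  obtain ⟨C, hC⟩ := h.exists_lipschitzWith hw hd hg hZ hO P
  have hAC := (hC.lipschitzOnWith (s := uIcc a t)).absolutelyContinuousOnInterval.sub
    ((hE t ht).const_mul p)
  have hmono := le_of_ae_hasDerivAt_nonpos ht.1 hAC ?_
  · have hinit : ‖⁅O, P⁆‖ ≤ p := by
      by_cases hdisj : Disjoint Z Y
      · rw [Ring.lie_def, (commute_of_disjoint hdisj hO hP).eq, sub_self, norm_zero]
        exact hp0
      · obtain ⟨z, hzZ, hzY⟩ := Finset.not_disjoint_iff.1 hdisj
        refine (norm_lie_le_two_mul _ _).trans (le_mul_of_one_le_right (by positivity) ?_)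
        exact (hwY z hzY).trans (Finset.single_le_sum (fun z _ => (hw z).le) hzZ)
    simp only [Pi.sub_apply, h.init, star_one, one_mul, mul_one, hEa] at hmono
    linarith
  · filter_upwards [hE'] with s hs hst e he
    have hsT : s ∈ Icc a T := ⟨hst.1, hst.2.trans ht.2⟩
    have h1 : HasDerivAt (fun s => ‖⁅star (U s) * O * U s, P⁆‖) (e + p * (g s * D s)) s := by
      refine (he.add ((hs hsT).const_mul p)).congr_of_eventuallyEq (Filter.Eventually.of_forall ?_)
      intro r
      simp
    have h2 := h.deriv_norm_lie_le hO P h1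
    have h3 : ∑ i with ¬Disjoint (B i) Z, ‖⁅star (U s) * K i s * U s, P⁆‖ ≤
        ‖P‖ * D s * (2 * ∑ i with ¬Disjoint (B i) Z, ‖K i s‖ * ∑ b ∈ B i, w b) := by
      rw [Finset.mul_sum, Finset.mul_sum]
      refine Finset.sum_le_sum fun i _ => (hD _ (h.subset i) _ (h.mem i s) s hsT).trans_eq ?_
      ring
    have h4 := mul_le_mul_of_nonneg_left (hd.sum_boundary_le hw hZ s)
      (mul_nonneg (norm_nonneg P) (hD₀ s hsT))
    have h5 := mul_le_mul_of_nonneg_left (h3.trans h4) (by positivity : 0 ≤ 2 * ‖O‖)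
    have h6 : 2 * ‖O‖ * (‖P‖ * D s * (g s * ∑ z ∈ Z, w z)) = p * (g s * D s) := by
      rw [hp]; ring
    linarith

/-- The Lieb–Robinson bound for a dominated local evolution. -/
theorem norm_lie_le (h : IsLocalEvolution B K U a) (hw : ∀ x, 0 < w x)
    (hd : IsDominated B K w g) (hgm : Measurable g) (hg₀ : ∀ t, 0 ≤ g t) {c : ℝ}
    (hg : ∀ t, g t ≤ c) {Y : Finset V} (hwY : ∀ y ∈ Y, 1 ≤ w y) {P : LocOp q Λ}
    (hP : P ∈ localAlgebra q Λ Y) {Z : Finset V} (hZ : Z ⊆ Λ) {O : LocOp q Λ}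
    (hO : O ∈ localAlgebra q Λ Z) {T : ℝ} (hT : a ≤ T) :
    ‖⁅star (U T) * O * U T, P⁆‖ ≤
      2 * ‖O‖ * ‖P‖ * (∑ z ∈ Z, w z) * Real.exp (∫ t in a..T, g t) := by
  have hgl : LocallyIntegrable g volume :=
    (locallyIntegrable_const c).mono hgm.aestronglyMeasurable <| ae_of_all _ fun t => by
      rw [Real.norm_of_nonneg (hg₀ t)]
      exact (hg t).trans (le_abs_self c)
  have hgi : ∀ s t, IntervalIntegrable g volume s t := fun s t =>
    intervalIntegrable_iff.2 ((hgl.integrableOn_isCompact isCompact_uIcc).mono_set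
      uIoc_subset_uIcc)
  set F : ℝ → ℝ := fun t => ∫ s in a..t, g s with hF
  have hF₀ : ∀ t, a ≤ t → 0 ≤ F t := fun t ht =>
    intervalIntegral.integral_nonneg ht fun s _ => hg₀ s
  have hFAC : ∀ t, AbsolutelyContinuousOnInterval F a t := fun t =>
    (hgi a t).absolutelyContinuousOnInterval_intervalIntegral left_mem_uIcc
  -- A lower bound on the weights makes the trivial commutator bound serve as the starting iterate,
  -- with `c = ε⁻¹`.
  obtain ⟨ε, hε, hεw⟩ : ∃ ε > 0, ∀ x ∈ Λ, ε ≤ w x := by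
    rcases Λ.eq_empty_or_nonempty with rfl | hne
    · exact ⟨1, one_pos, by simp⟩
    · obtain ⟨x, _, hmin⟩ := Λ.exists_min_image w hne
      exact ⟨w x, hw x, hmin⟩
  have key : ∀ n : ℕ, ∀ Z ⊆ Λ, ∀ O ∈ localAlgebra q Λ Z, ∀ t ∈ Icc a T,
      ‖⁅star (U t) * O * U t, P⁆‖ ≤
        2 * ‖O‖ * ‖P‖ * (∑ z ∈ Z, w z) * picardPoly ε⁻¹ n (F t) := by
    intro n
    induction n with
    | zero =>
      intro Z hZ O hO t _
      simp only [picardPoly, Finset.range_zero, Finset.sum_empty, pow_zero, Nat.factorial_zero,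
        Nat.cast_one, div_one, mul_one, zero_add]
      -- For empty `Z` the claimed bound is zero; it holds because `O` commutes with every operator.
      rcases Z.eq_empty_or_nonempty with rfl | ⟨z, hz⟩
      · have hc : ∀ M : LocOp q Λ, Commute O M := fun M =>
          commute_of_disjoint (Finset.disjoint_empty_left Λ) hO (mem_localAlgebra_self M)
        rw [mul_assoc, (hc (U t)).eq, ← mul_assoc, (Unitary.mem_iff.1 (h.mem_unitary t)).1,
          one_mul, Ring.lie_def, (hc P).eq, sub_self, norm_zero]
        simp
      · refine (norm_lie_le_two_mul _ _).trans ?_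
        rw [norm_star_mul_mul (h.mem_unitary t), mul_assoc _ (∑ z ∈ Z, w z)]
        refine le_mul_of_one_le_right (by positivity) ?_
        rw [← div_eq_mul_inv, one_le_div hε]
        exact (hεw z (hZ hz)).trans (Finset.single_le_sum (fun z _ => (hw z).le) hz)
    | succ n ih =>
      intro Z hZ O hO t ht
      refine h.norm_lie_le_of_le hw hd hg hwY hP (D := fun t => picardPoly ε⁻¹ n (F t))
        (E := fun t => picardPoly ε⁻¹ (n + 1) (F t)) ?_ ih ?_ ?_ ?_ hZ hO ht
      · intro s hs
        have := hF₀ s hs.1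
        exact add_nonneg (Finset.sum_nonneg fun k _ => by positivity) (by positivity)
      · simp only [hF, intervalIntegral.integral_same]
        exact picardPoly_succ_zero _ _
      · exact fun s _ => absolutelyContinuous_picardPoly (hFAC s) _ _
      -- Lebesgue differentiation, followed by the chain rule.
      · filter_upwards [_root_.LocallyIntegrable.ae_hasDerivAt_integral hgl] with s hs _
        rw [mul_comm]
        exact (hasDerivAt_picardPoly ε⁻¹ n (F s)).comp s (hs a)
  refine le_mul_exp_of_forall_picardPoly (c := ε⁻¹) ?_ (hF₀ T hT) fun n =>
    key n Z hZ O hO T ⟨hT, le_rfl⟩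
  have : 0 ≤ ∑ z ∈ Z, w z := Finset.sum_nonneg fun z _ => (hw z).le
  positivity

end IsLocalEvolution

end AbstractBound

/-! ### Lattice geometry and the time-dependent bound -/

section QuasiLocal

open MeasureTheory Set

section Geometry

variable {V : Type*} {G : SimpleGraph V}

theorem dist_le_diam {A : Finset V} {x y : V} (hx : x ∈ A) (hy : y ∈ A) :
    G.dist x y ≤ diam G A :=
  (Finset.le_sup (f := fun y => G.dist x y) hy).trans
    (Finset.le_sup (f := fun x => A.sup fun y => G.dist x y) hx)

theorem diam_le {A : Finset V} {n : ℕ} (h : ∀ x ∈ A, ∀ y ∈ A, G.dist x y ≤ n) : diam G A ≤ n :=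
  Finset.sup_le fun x hx => Finset.sup_le fun y hy => h x hx y hy

theorem setDist_le {X Y : Finset V} {x y : V} (hx : x ∈ X) (hy : y ∈ Y) :
    setDist G X Y ≤ G.dist x y := Nat.sInf_le ⟨x, hx, y, hy, rfl⟩

/-- The infimum of the empty set of naturals is zero by convention. -/
theorem setDist_empty_right (X : Finset V) : setDist G X ∅ = 0 := by
  simp [setDist]

theorem exists_dist_eq_setDist {X Y : Finset V} (hX : X.Nonempty) (hY : Y.Nonempty) :
    ∃ x ∈ X, ∃ y ∈ Y, G.dist x y = setDist G X Y := by
  obtain ⟨x, hx⟩ := hX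
  obtain ⟨y, hy⟩ := hY
  exact Nat.sInf_mem (s := {n : ℕ | ∃ x ∈ X, ∃ y ∈ Y, G.dist x y = n}) ⟨_, x, hx, y, hy, rfl⟩

theorem setDist_comm (X Y : Finset V) : setDist G X Y = setDist G Y X := by
  unfold setDist
  congr 1
  ext n
  constructor
  · rintro ⟨x, hx, y, hy, h⟩
    exact ⟨y, hy, x, hx, SimpleGraph.dist_comm.trans h⟩
  · rintro ⟨x, hx, y, hy, h⟩
    exact ⟨y, hy, x, hx, SimpleGraph.dist_comm.trans h⟩

theorem setDist_singleton_le (hG : G.Connected) (x b : V) (Y : Finset V) :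
    setDist G {x} Y ≤ G.dist x b + setDist G {b} Y := by
  rcases Y.eq_empty_or_nonempty with rfl | hY
  · simp [setDist_empty_right]
  · obtain ⟨b', hb', y, hy, h⟩ := exists_dist_eq_setDist (G := G) (Finset.singleton_nonempty b) hY
    obtain rfl := Finset.mem_singleton.1 hb'
    rw [← h]
    exact (setDist_le (Finset.mem_singleton_self x) hy).trans hG.dist_triangle

theorem setDist_le_singleton {X : Finset V} {x : V} (hx : x ∈ X) (Y : Finset V) :
    setDist G X Y ≤ setDist G {x} Y := by
  rcases Y.eq_empty_or_nonempty with rfl | hY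
  · simp [setDist_empty_right]
  · obtain ⟨x', hx', y, hy, h⟩ := exists_dist_eq_setDist (G := G) (Finset.singleton_nonempty x) hY
    obtain rfl := Finset.mem_singleton.1 hx'
    rw [← h]
    exact setDist_le hx hy

/-- Balls are finite, since a large subset of a ball of radius `n` still has diameter at most `2 *
n`. Countability is needed for the interaction norm to be measurable in time. -/
theorem countable_of_card_le (hG : G.Connected) {d : ℕ} {C : ℝ}
    (hC : ∀ A : Finset V, (A.card : ℝ) ≤ C * ((diam G A : ℝ) + 1) ^ d) : Countable V := by
  obtain ⟨x₀⟩ := hG.nonempty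
  -- The volume bound for the empty region.
  have hC0 : 0 ≤ C := by simpa [diam] using hC ∅
  have hfin : ∀ n : ℕ, {x | G.dist x₀ x ≤ n}.Finite := by
    intro n
    by_contra hinf
    obtain ⟨m, hm⟩ := exists_nat_gt (C * ((2 * n : ℕ) + 1 : ℝ) ^ d)
    obtain ⟨A, hA, hcard⟩ := Set.Infinite.exists_subset_card_eq hinf m
    have hdiam : diam G A ≤ 2 * n := diam_le fun x hx y hy => by
      have h1 : G.dist x₀ x ≤ n := hA hx
      have h2 : G.dist x₀ y ≤ n := hA hy
      have h3 := hG.dist_triangle (u := x) (v := x₀) (w := y)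
      rw [SimpleGraph.dist_comm (u := x) (v := x₀)] at h3
      omega
    have h1 := hC A
    rw [hcard] at h1
    have h2 : C * ((diam G A : ℝ) + 1) ^ d ≤ C * ((2 * n : ℕ) + 1 : ℝ) ^ d := by
      have : (diam G A : ℝ) ≤ (2 * n : ℕ) := by exact_mod_cast hdiam
      gcongr
    linarith
  have huniv : (⋃ n : ℕ, {x | G.dist x₀ x ≤ n}) = Set.univ :=
    Set.eq_univ_of_forall fun x => Set.mem_iUnion.2 ⟨G.dist x₀ x, le_refl (G.dist x₀ x)⟩
  rw [← Set.countable_univ_iff, ← huniv]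
  exact Set.countable_iUnion fun n => (hfin n).countable

/-- The function `z ^ d * exp (-η z)` is maximal at `z = d / η`; the inequality `y ≤ exp (y - 1)` at
`y = η z / d` proves this. -/
theorem pow_le_exp_mul (d : ℕ) {η z : ℝ} (hη : 0 < η) (hz : 0 ≤ z) :
    z ^ d ≤ Real.exp (η * z) * (d / (Real.exp 1 * η)) ^ d := by
  rcases Nat.eq_zero_or_pos d with rfl | hd
  · simpa using mul_nonneg hη.le hz
  · have hd' : (0 : ℝ) < d := by exact_mod_cast hd
    have h1 : η * z / d ≤ Real.exp (η * z / d - 1) := by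
      linarith [Real.add_one_le_exp (η * z / d - 1)]
    have h2 : (η * z / d) ^ d ≤ Real.exp (η * z - d) := by
      refine (pow_le_pow_left₀ (by positivity) h1 d).trans_eq ?_
      rw [← Real.exp_nat_mul]
      congr 1
      field_simp
    have h3 : z ^ d = (η * z / d) ^ d * (d / η) ^ d := by
      rw [← mul_pow]
      congr 1
      field_simp
    have h4 : Real.exp (η * z) * (d / (Real.exp 1 * η)) ^ d =
        Real.exp (η * z - d) * (d / η) ^ d := by
      rw [Real.exp_sub, div_pow, div_pow, mul_pow, ← Real.exp_nat_mul, mul_one]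
      have := Real.exp_pos (d : ℝ)
      field_simp
    rw [h3, h4]
    exact mul_le_mul_of_nonneg_right h2 (by positivity)

/-- The decaying weight `exp (-κ dist(x, Y))` of a site. -/
def siteWeight (G : SimpleGraph V) (κ : ℝ) (Y : Finset V) (x : V) : ℝ :=
  Real.exp (-κ * (setDist G {x} Y : ℝ))

theorem siteWeight_pos (κ : ℝ) (Y : Finset V) (x : V) : 0 < siteWeight G κ Y x := Real.exp_pos _

theorem sum_siteWeight_le {κ : ℝ} (hκ : 0 < κ) (X Y : Finset V) :
    ∑ x ∈ X, siteWeight G κ Y x ≤ X.card * Real.exp (-κ * (setDist G X Y : ℝ)) := by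
  rw [← nsmul_eq_mul]
  refine Finset.sum_le_card_nsmul _ _ _ fun x hx => Real.exp_le_exp.2 ?_
  have : (setDist G X Y : ℝ) ≤ setDist G {x} Y := by exact_mod_cast setDist_le_singleton hx Y
  nlinarith

theorem exp_mul_siteWeight_ge_one {κ : ℝ} (hκ : 0 < κ) {Y : Finset V} {x y : V} (hy : y ∈ Y)
    {n : ℕ} (h : G.dist x y ≤ n) : 1 ≤ Real.exp (κ * n) * siteWeight G κ Y x := by
  rw [siteWeight, ← Real.exp_add]
  refine Real.one_le_exp ?_
  have : (setDist G {x} Y : ℝ) ≤ n := by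
    exact_mod_cast (setDist_le (Finset.mem_singleton_self x) hy).trans h
  nlinarith

theorem siteWeight_le (hG : G.Connected) {κ : ℝ} (hκ : 0 < κ) (Y : Finset V) {A : Finset V}
    {x b : V} (hx : x ∈ A) (hb : b ∈ A) :
    siteWeight G κ Y b ≤ Real.exp (κ * diam G A) * siteWeight G κ Y x := by
  rw [siteWeight, siteWeight, ← Real.exp_add]
  refine Real.exp_le_exp.2 ?_
  have h : (setDist G {x} Y : ℝ) ≤ diam G A + setDist G {b} Y := by
    exact_mod_cast (setDist_singleton_le hG x b Y).trans
      (Nat.add_le_add_right (dist_le_diam hx hb) _)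
  nlinarith

/-- The exponent `κ` pays for the variation of the weight over `A` and `η` for the number of sites;
`exp η` comes from the `+ 1` in the volume bound. -/
theorem sum_region_siteWeight_le (hG : G.Connected) {d : ℕ} {C : ℝ}
    (hC : ∀ A : Finset V, (A.card : ℝ) ≤ C * ((diam G A : ℝ) + 1) ^ d) {κ η : ℝ} (hκ : 0 < κ)
    (hη : 0 < η) (Y : Finset V) {A : Finset V} {x : V} (hx : x ∈ A) :
    ∑ b ∈ A, siteWeight G κ Y b ≤ C * Real.exp η * (d / (Real.exp 1 * η)) ^ d *
      Real.exp ((κ + η) * diam G A) * siteWeight G κ Y x := by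
  have hC0 : 0 ≤ C := by simpa [diam] using hC ∅
  have hw := siteWeight_pos (G := G) κ Y x
  have hA := hC A
  have h1 := pow_le_exp_mul d hη (by positivity : 0 ≤ (diam G A : ℝ) + 1)
  calc _ ≤ A.card * (Real.exp (κ * diam G A) * siteWeight G κ Y x) := by
        rw [← nsmul_eq_mul]
        exact Finset.sum_le_card_nsmul _ _ _ fun b hb => siteWeight_le hG hκ Y hx hb
    _ ≤ C * ((diam G A : ℝ) + 1) ^ d * (Real.exp (κ * diam G A) * siteWeight G κ Y x) := by
        gcongr
    _ ≤ C * (Real.exp (η * ((diam G A : ℝ) + 1)) * (d / (Real.exp 1 * η)) ^ d) *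
          (Real.exp (κ * diam G A) * siteWeight G κ Y x) := by gcongr
    _ = _ := by
      rw [show η * ((diam G A : ℝ) + 1) = η * diam G A + η by ring,
        show (κ + η) * (diam G A : ℝ) = η * diam G A + κ * diam G A by ring, Real.exp_add,
        Real.exp_add]
      ring

end Geometry

variable {V : Type*} [DecidableEq V] {G : SimpleGraph V} {q : V → ℕ}

theorem sum_le_interactionNorm {μ : ℝ} {Φ : Interaction q} (hΦ : interactionNorm G μ Φ ≠ ⊤)
    {x : V} {S : Finset (Finset V)} (hS : ∀ A ∈ S, x ∈ A) :
    ∑ A ∈ S, ‖Φ A‖ * Real.exp (μ * diam G A) ≤ (interactionNorm G μ Φ).toReal := by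
  rw [← ENNReal.ofReal_le_iff_le_toReal hΦ, ENNReal.ofReal_sum_of_nonneg fun A _ => by positivity,
    ← Finset.sum_subtype_of_mem (p := fun A => x ∈ A) _ hS]
  exact (ENNReal.sum_le_tsum _).trans
    (le_iSup (fun j : V => ∑' A : {A : Finset V // j ∈ A},
      ENNReal.ofReal (‖Φ A.1‖ * Real.exp (μ * (diam G A.1 : ℝ)))) x)

theorem interactionNorm_neg (μ : ℝ) (Φ : Interaction q) :
    interactionNorm G μ (fun A => -Φ A) = interactionNorm G μ Φ := by
  simp only [interactionNorm, norm_neg]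

theorem measurable_interactionNorm [Countable V] {H : ℝ → Interaction q}
    (hH : ∀ A, StronglyMeasurable fun t => H t A) (μ : ℝ) :
    Measurable fun t => interactionNorm G μ (H t) :=
  Measurable.iSup fun _ => Measurable.tsum fun A =>
    ((hH A.1).norm.measurable.mul_const _).ennreal_ofReal

/-- Domination is homogeneous in the weight, so the factor `c` is free; it later makes the weight at
least one on an enlarged `Y`. -/
theorem isDominated_siteWeight (hG : G.Connected) {d : ℕ} {C : ℝ}
    (hC : ∀ A : Finset V, (A.card : ℝ) ≤ C * ((diam G A : ℝ) + 1) ^ d) {κ η : ℝ} (hκ : 0 < κ)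
    (hη : 0 < η) (Y : Finset V) {c : ℝ} (hc : 0 ≤ c) {Λ : Finset V} {ι : Type*} [Fintype ι]
    {B : ι → Finset V} {K : ι → ℝ → LocOp q Λ} {N : ℝ → ℝ}
    (hN : ∀ x ∈ Λ, ∀ t,
      ∑ i with x ∈ B i, ‖K i t‖ * Real.exp ((κ + η) * diam G (B i)) ≤ N t) :
    IsLocalEvolution.IsDominated B K (fun x => c * siteWeight G κ Y x)
      fun t => 2 * C * Real.exp η * (d / (Real.exp 1 * η)) ^ d * N t := by
  intro x hx t
  have hC0 : 0 ≤ C := by simpa [diam] using hC ∅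
  have hw := siteWeight_pos (G := G) κ Y x
  have h1 : ∑ i with x ∈ B i, ‖K i t‖ * ∑ b ∈ B i, c * siteWeight G κ Y b ≤
      (c * (C * Real.exp η * (d / (Real.exp 1 * η)) ^ d) * siteWeight G κ Y x) *
        ∑ i with x ∈ B i, ‖K i t‖ * Real.exp ((κ + η) * diam G (B i)) := by
    rw [Finset.mul_sum]
    refine Finset.sum_le_sum fun i hi => ?_
    rw [← Finset.mul_sum]
    have h2 := mul_le_mul_of_nonneg_left (sum_region_siteWeight_le hG hC hκ hη Y
      (Finset.mem_filter.1 hi).2) (mul_nonneg (norm_nonneg (K i t)) hc)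
    refine le_trans (le_of_eq ?_) (h2.trans_eq ?_) <;> ring
  have h3 := mul_le_mul_of_nonneg_left (hN x hx t) (by positivity :
    0 ≤ c * (C * Real.exp η * (d / (Real.exp 1 * η)) ^ d) * siteWeight G κ Y x)
  calc _ ≤ 2 * ((c * (C * Real.exp η * (d / (Real.exp 1 * η)) ^ d) * siteWeight G κ Y x) * N t) := by
        linarith
    _ = _ := by ring

theorem isSelfAdjoint_extend {A Λ : Finset V} (h : A ⊆ Λ) {M : LocOp q A} (hM : M.IsHermitian) :
    IsSelfAdjoint (extend h M) := by
  rw [isSelfAdjoint_iff, ← extend_star, Matrix.star_eq_conjTranspose, hM.eq]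

theorem extend_neg {A Λ : Finset V} (h : A ⊆ Λ) (M : LocOp q A) : extend h (-M) = -extend h M :=
  map_neg (extendHom h) M

theorem hamiltonian_neg (Λ : Finset V) (Φ : Interaction q) :
    hamiltonian Λ (fun A => -Φ A) = -hamiltonian Λ Φ := by
  simp only [hamiltonian, extend_neg, Finset.sum_neg_distrib]

theorem isSelfAdjoint_hamiltonian (Λ : Finset V) {Φ : Interaction q}
    (hΦ : ∀ A, (Φ A).IsHermitian) : IsSelfAdjoint (hamiltonian Λ Φ) :=
  isSelfAdjoint_sum _ fun A _ => isSelfAdjoint_extend _ (hΦ A.1)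

theorem norm_lie_conj {n : Type*} [Fintype n] [DecidableEq n] {u : Matrix n n ℂ}
    (hu : u ∈ unitary (Matrix n n ℂ)) (x y : Matrix n n ℂ) :
    ‖⁅star u * x * u, y⁆‖ = ‖⁅u * y * star u, x⁆‖ := by
  have h1 : star u * u = 1 := (Unitary.mem_iff.1 hu).1
  have h : ⁅star u * x * u, y⁆ = -(star u * ⁅u * y * star u, x⁆ * u) := by
    have e1 : star u * (u * y * star u * x) * u = (star u * u) * y * (star u * x * u) := by
      noncomm_ring
    have e2 : star u * (x * (u * y * star u)) * u = star u * x * u * y * (star u * u) := by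
      noncomm_ring
    rw [Ring.lie_def, Ring.lie_def, mul_sub, sub_mul, e1, e2, h1, one_mul, mul_one, neg_sub]
  rw [h, norm_neg, norm_star_mul_mul hu]

theorem lieb_robinson_card_left (hG : G.Connected) {d : ℕ} {C : ℝ}
    (hC : ∀ A : Finset V, (A.card : ℝ) ≤ C * ((diam G A : ℝ) + 1) ^ d)
    {H : ℝ → Interaction q} (hH : ∀ t A, (H t A).IsHermitian)
    (hHm : ∀ A, StronglyMeasurable fun t => H t A) {κ η : ℝ} (hκ : 0 < κ) (hη : 0 < η)
    {c : NNReal} (hHc : ∀ t, interactionNorm G (κ + η) (H t) ≤ c) {Λ : Finset V}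
    {U : ℝ → LocOp q Λ} {a T : ℝ} (haT : a ≤ T) (hUa : U a = 1)
    (hU : ∀ t, HasDerivAt U (-Complex.I • (hamiltonian Λ (H t) * U t)) t) {X Y : Finset V}
    (hX : X ⊆ Λ) (hY : Y ⊆ Λ) (OX : LocOp q X) (OY : LocOp q Y) :
    ‖⁅star (U T) * extend hX OX * U T, extend hY OY⁆‖ ≤
      2 * X.card * ‖OX‖ * ‖OY‖ * Real.exp (-κ * ((setDist G X Y : ℝ) -
        2 * C * Real.exp η / κ * (d / (Real.exp 1 * η)) ^ d *
          ∫ s in a..T, (interactionNorm G (κ + η) (H s)).toReal)) := by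
  have := countable_of_card_le hG hC
  have hC0 : 0 ≤ C := by simpa [diam] using hC ∅
  have htop : ∀ t, interactionNorm G (κ + η) (H t) ≠ ⊤ := fun t =>
    ne_top_of_le_ne_top ENNReal.coe_ne_top (hHc t)
  set N : ℝ → ℝ := fun t => (interactionNorm G (κ + η) (H t)).toReal with hNdef
  have hNc : ∀ t, N t ≤ c := fun t => by
    simpa using ENNReal.toReal_mono ENNReal.coe_ne_top (hHc t)
  set v : ℝ := 2 * C * Real.exp η * (d / (Real.exp 1 * η)) ^ d with hv
  have hv0 : 0 ≤ v := by positivity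
  have hev : IsLocalEvolution (fun A : {A : Finset V // A ∈ Λ.powerset} => A.1)
      (fun A t => extend (Finset.mem_powerset.1 A.2) (H t A.1)) U a :=
    ⟨fun A => Finset.mem_powerset.1 A.2, fun A t => isSelfAdjoint_extend _ (hH t A.1),
      fun A t => extend_mem_localAlgebra _ (Finset.Subset.refl _) _, hUa, hU⟩
  have hdom : IsLocalEvolution.IsDominated (fun A : {A : Finset V // A ∈ Λ.powerset} => A.1)
      (fun A t => extend (Finset.mem_powerset.1 A.2) (H t A.1))
      (fun x => 1 * siteWeight G κ Y x) fun t => v * N t := by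
    refine isDominated_siteWeight hG hC hκ hη Y zero_le_one fun x _ t => ?_
    refine le_trans ?_ (sum_le_interactionNorm (htop t) (x := x)
      (S := {A ∈ Λ.powerset | x ∈ A}) fun A hA => (Finset.mem_filter.1 hA).2)
    rw [Finset.sum_filter, Finset.sum_filter, ← Finset.sum_coe_sort Λ.powerset]
    refine Finset.sum_le_sum fun A _ => ?_
    split_ifs
    · exact mul_le_mul_of_nonneg_right (norm_extend_le _ _) (Real.exp_pos _).le
    · exact le_rfl
  have hmain := hev.norm_lie_le (fun x => by simpa using siteWeight_pos κ Y x) hdom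
    ((measurable_interactionNorm hHm (κ + η)).ennreal_toReal.const_mul v)
    (fun t => mul_nonneg hv0 ENNReal.toReal_nonneg)
    (fun t => mul_le_mul_of_nonneg_left (hNc t) hv0)
    (fun y hy => by
      simpa using exp_mul_siteWeight_ge_one hκ (G := G) (n := 0) hy (by simp))
    (extend_mem_localAlgebra hY (Finset.Subset.refl Y) OY) hX
    (extend_mem_localAlgebra hX (Finset.Subset.refl X) OX) haT
  refine hmain.trans ?_
  have h1 := norm_extend_le hX OX
  have h2 := norm_extend_le hY OY
  have h3 := sum_siteWeight_le (G := G) hκ X Y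
  have h0 : 0 ≤ ∑ x ∈ X, siteWeight G κ Y x :=
    Finset.sum_nonneg fun x _ => (siteWeight_pos κ Y x).le
  simp only [one_mul]
  calc _ ≤ 2 * ‖OX‖ * ‖OY‖ * (X.card * Real.exp (-κ * (setDist G X Y : ℝ))) *
        Real.exp (∫ t in a..T, v * N t) := by gcongr
    _ = _ := by
      rw [intervalIntegral.integral_const_mul, mul_assoc _ (_ * _) (Real.exp _),
        mul_assoc (X.card : ℝ), ← Real.exp_add]
      have e : -κ * (setDist G X Y : ℝ) + v * ∫ t in a..T, N t =
          -κ * ((setDist G X Y : ℝ) - 2 * C * Real.exp η / κ * (d / (Real.exp 1 * η)) ^ d *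
            ∫ s in a..T, N s) := by
        rw [hv]
        field_simp
        ring
      rw [e]
      ring

theorem lieb_robinson (hG : G.Connected) {d : ℕ} {C : ℝ}
    (hC : ∀ A : Finset V, (A.card : ℝ) ≤ C * ((diam G A : ℝ) + 1) ^ d)
    {H : ℝ → Interaction q} (hH : ∀ t A, (H t A).IsHermitian)
    (hHm : ∀ A, StronglyMeasurable fun t => H t A) {κ η : ℝ} (hκ : 0 < κ) (hη : 0 < η)
    {c : NNReal} (hHc : ∀ t, interactionNorm G (κ + η) (H t) ≤ c) {Λ : Finset V}
    {U : ℝ → ℝ → LocOp q Λ} (hU : IsPropagator (fun t => hamiltonian Λ (H t)) U)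
    {X Y : Finset V} (hX : X ⊆ Λ) (hY : Y ⊆ Λ) (OX : LocOp q X) (OY : LocOp q Y) {t' t : ℝ}
    (ht : t' ≤ t) :
    ‖⁅star (U t t') * extend hX OX * U t t', extend hY OY⁆‖ ≤
      2 * (min X.card Y.card : ℕ) * ‖OX‖ * ‖OY‖ * Real.exp (-κ * ((setDist G X Y : ℝ) -
        2 * C * Real.exp η / κ * (d / (Real.exp 1 * η)) ^ d *
          ∫ s in t'..t, (interactionNorm G (κ + η) (H s)).toReal)) := by
  rcases le_total X.card Y.card with hXY | hXY
  · rw [min_eq_left hXY]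
    exact lieb_robinson_card_left hG hC hH hHm hκ hη hHc (U := fun s => U s t') ht (hU t').1
      (hU t').2 hX hY OX OY
  · rw [min_eq_right hXY]
    have hsa : ∀ s, IsSelfAdjoint (hamiltonian Λ (H s)) := fun s =>
      isSelfAdjoint_hamiltonian Λ (hH s)
    -- The evolution is run backwards from `t`: the reversed propagator is generated by `-H (t -
    -- s)`, and `Y` takes the role of `X`.
    have hinv : U t' t = star (U t t') := by
      have h := star_mul_eq_star_mul (U₁ := fun s => U s t') (U₂ := fun s => U s t) hsa (hU t').2
        (hU t).2 t' t
      rwa [(hU t').1, (hU t).1, star_one, one_mul, mul_one] at h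
    have hrev : ∀ s, HasDerivAt (fun s => U (t - s) t)
        (-Complex.I • (hamiltonian Λ (fun A => -H (t - s) A) * U (t - s) t)) s := by
      intro s
      have h := ((hU t).2 (t - s)).scomp s ((hasDerivAt_id s).const_sub t)
      refine h.congr_deriv ?_
      rw [hamiltonian_neg]
      simp
    have h := lieb_robinson_card_left hG hC (H := fun s A => -H (t - s) A)
      (U := fun s => U (t - s) t) (a := 0) (T := t - t')
      (fun s A => (hH _ A).neg)
      (fun A => ((hHm A).comp_measurable (measurable_const.sub measurable_id)).neg) hκ hη
      (c := c) (fun s => by rw [interactionNorm_neg]; exact hHc _)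
      (sub_nonneg.2 ht) (by simpa using (hU t).1) hrev hY hX OY OX
    simp only [interactionNorm_neg, sub_sub_cancel, hinv, star_star] at h
    rw [intervalIntegral.integral_comp_sub_left
      (fun s => (interactionNorm G (κ + η) (H s)).toReal), sub_sub_cancel, sub_zero,
      setDist_comm] at h
    rw [norm_lie_conj (mem_unitary_of_hasDerivAt (U := fun s => U s t') hsa (hU t').1 (hU t').2 t)]
    exact h.trans_eq (by ring)

end QuasiLocal

/-! ### Perturbations of commuting Hamiltonians -/

section CommutingPerturbation

open MeasureTheory Set

section UnitaryGroup

variable {n : Type*} [Fintype n] [DecidableEq n]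

/-- The one-parameter group `exp (i r A)`. -/
def expI (A : Matrix n n ℂ) (r : ℝ) : Matrix n n ℂ := NormedSpace.exp ((Complex.I * (r : ℂ)) • A)

theorem expI_zero (A : Matrix n n ℂ) : expI A 0 = 1 := by simp [expI]

theorem expI_add_of_commute {A A' : Matrix n n ℂ} (h : Commute A A') (r : ℝ) :
    expI (A + A') r = expI A r * expI A' r := by
  rw [expI, smul_add]
  exact Matrix.exp_add_of_commute _ _ ((h.smul_left _).smul_right _)

theorem expI_mul_neg (A : Matrix n n ℂ) (r : ℝ) : expI A r * expI A (-r) = 1 := by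
  rw [expI, expI, ← Matrix.exp_add_of_commute, ← add_smul]
  · simp
  · exact ((Commute.refl A).smul_left _).smul_right _

theorem expI_neg_mul (A : Matrix n n ℂ) (r : ℝ) : expI A (-r) * expI A r = 1 := by
  simpa using expI_mul_neg A (-r)

theorem neg_expI (A : Matrix n n ℂ) (r : ℝ) : expI (-A) r = expI A (-r) := by
  simp [expI]

theorem star_expI {A : Matrix n n ℂ} (hA : IsSelfAdjoint A) (r : ℝ) :
    star (expI A r) = expI A (-r) := by
  rw [expI, expI, NormedSpace.star_exp, star_smul, hA.star_eq]
  simp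

theorem expI_mem_unitary {A : Matrix n n ℂ} (hA : IsSelfAdjoint A) (r : ℝ) :
    expI A r ∈ unitary (Matrix n n ℂ) := by
  rw [Unitary.mem_iff, star_expI hA]
  exact ⟨expI_neg_mul A r, expI_mul_neg A r⟩

theorem commute_expI {A M : Matrix n n ℂ} (h : Commute A M) (r : ℝ) : Commute (expI A r) M :=
  (h.smul_left _).exp_left

theorem hasDerivAt_expI (A : Matrix n n ℂ) (r : ℝ) :
    HasDerivAt (expI A) (expI A r * (Complex.I • A)) r := by
  have h : ∀ s : ℝ, (Complex.I * (s : ℂ)) • A = s • (Complex.I • A) := fun s => by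
    rw [mul_comm, mul_smul, Complex.coe_smul]
  unfold expI
  simp only [h]
  exact hasDerivAt_exp_smul_const (𝕂 := ℝ) (Complex.I • A) r

/-- The Dyson equation of the interaction picture, with the free evolution factored out on the
right. -/
theorem hasDerivAt_interactionPicture (A W : Matrix n n ℂ) (T s : ℝ) :
    HasDerivAt (fun s => expI A (s - T) * expI (A + W) (-s) * expI A T)
      (-Complex.I • (expI A (s - T) * W * expI A (-(s - T)) *
        (expI A (s - T) * expI (A + W) (-s) * expI A T))) s := by
  have h1 : HasDerivAt (fun s => expI A (s - T)) (expI A (s - T) * (Complex.I • A)) s :=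
    (hasDerivAt_expI A (s - T)).comp_sub_const s T
  have h2 : HasDerivAt (fun s => expI (A + W) (-s))
      (-((Complex.I • (A + W)) * expI (A + W) (-s))) s := by
    have h := (hasDerivAt_expI (A + W) (-s)).scomp s (hasDerivAt_neg s)
    refine h.congr_deriv ?_
    rw [neg_one_smul, ((commute_expI (Commute.refl (A + W)) (-s)).smul_right Complex.I).eq]
  refine ((h1.mul h2).mul_const (expI A T)).congr_deriv ?_
  have h3 : expI A (s - T) * W * expI A (-(s - T)) *
        (expI A (s - T) * expI (A + W) (-s) * expI A T) =
      expI A (s - T) * W * (expI A (-(s - T)) * expI A (s - T)) *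
        (expI (A + W) (-s) * expI A T) := by noncomm_ring
  rw [h3, expI_neg_mul, mul_one, smul_add, add_mul]
  simp only [smul_mul_assoc, mul_smul_comm, mul_neg, neg_mul, mul_assoc, neg_smul, neg_add,
    mul_add, add_mul, add_neg_cancel_left]

end UnitaryGroup

variable {V : Type*} [DecidableEq V] {G : SimpleGraph V} {q : V → ℕ}

theorem heisenberg_eq {Λ : Finset V} (H O : LocOp q Λ) (t : ℝ) :
    heisenberg H O t = expI H t * O * expI H (-t) := by
  simp [heisenberg, expI]

theorem expI_mem_localAlgebra {Λ A : Finset V} {M : LocOp q Λ} (hM : M ∈ localAlgebra q Λ A)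
    (r : ℝ) : expI M r ∈ localAlgebra q Λ A :=
  exp_mem_localAlgebra (SMulMemClass.smul_mem _ hM)

/-- The term `h_j` as an operator on `Λ`, or zero if its region is not contained in `Λ`. -/
def siteTerm (Λ : Finset V) (R : V → Finset V) (h : (j : V) → LocOp q (R j)) (j : V) :
    LocOp q Λ :=
  if hj : R j ⊆ Λ then extend hj (h j) else 0

section SiteTerm

variable {Λ : Finset V} {R : V → Finset V} {h : (j : V) → LocOp q (R j)}

theorem siteHamiltonian_eq_sum : siteHamiltonian Λ R h = ∑ j ∈ Λ, siteTerm Λ R h j :=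
  Finset.sum_coe_sort Λ (siteTerm Λ R h)

theorem siteTerm_neg (j : V) : siteTerm Λ R (fun j => -h j) j = -siteTerm Λ R h j := by
  unfold siteTerm
  split_ifs
  · exact extend_neg _ _
  · exact neg_zero.symm

theorem siteHamiltonian_neg : siteHamiltonian Λ R (fun j => -h j) = -siteHamiltonian Λ R h := by
  simp only [siteHamiltonian_eq_sum, siteTerm_neg, Finset.sum_neg_distrib]

theorem isSelfAdjoint_siteTerm (hh : ∀ j, (h j).IsHermitian) (j : V) :
    IsSelfAdjoint (siteTerm Λ R h j) := by
  unfold siteTerm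
  split_ifs
  · exact isSelfAdjoint_extend _ (hh j)
  · exact IsSelfAdjoint.zero _

theorem isSelfAdjoint_siteHamiltonian (hh : ∀ j, (h j).IsHermitian) :
    IsSelfAdjoint (siteHamiltonian Λ R h) := by
  rw [siteHamiltonian_eq_sum]
  exact isSelfAdjoint_sum _ fun j _ => isSelfAdjoint_siteTerm hh j

theorem commute_siteTerm (hcomm : IsCommuting R h) (j j' : V) :
    Commute (siteTerm Λ R h j) (siteTerm Λ R h j') := by
  unfold siteTerm
  split_ifs with h1 h2
  · have hc := (hcomm j j').map (extendHom (Finset.union_subset h1 h2))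
    rwa [extendHom_apply, extendHom_apply, extend_extend, extend_extend] at hc
  · exact Commute.zero_right _
  · exact Commute.zero_left _
  · exact Commute.zero_left _

theorem siteTerm_mem_localAlgebra (j : V) {A : Finset V} (hA : R j ⊆ Λ → R j ⊆ A) :
    siteTerm Λ R h j ∈ localAlgebra q Λ A := by
  unfold siteTerm
  split_ifs with hj
  · exact extend_mem_localAlgebra hj (hA hj) _
  · exact zero_mem _

theorem isCommuting_neg (hcomm : IsCommuting R h) : IsCommuting R fun j => -h j := by
  intro j j'
  rw [extend_neg, extend_neg]
  exact (hcomm j j').neg_left.neg_right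

/-- The region `A` together with all regions `R_j ⊆ Λ` that meet it. -/
def fattening (Λ : Finset V) (R : V → Finset V) (A : Finset V) : Finset V :=
  A ∪ {j ∈ Λ | R j ⊆ Λ ∧ ¬Disjoint (R j) A}.biUnion R

theorem subset_fattening (A : Finset V) : A ⊆ fattening Λ R A := Finset.subset_union_left

theorem fattening_subset {A : Finset V} (hA : A ⊆ Λ) : fattening Λ R A ⊆ Λ :=
  Finset.union_subset hA <| Finset.biUnion_subset.2 fun _ hj => (Finset.mem_filter.1 hj).2.1

/-- A site already in `A` is covered by its own region, because `x ∈ R x`. -/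
theorem exists_of_mem_fattening (hR : ∀ j, j ∈ R j) {A : Finset V} {x : V}
    (hx : x ∈ fattening Λ R A) : ∃ a ∈ A, ∃ j, x ∈ R j ∧ a ∈ R j := by
  rcases Finset.mem_union.1 hx with hx | hx
  · exact ⟨x, hx, x, hR x, hR x⟩
  · obtain ⟨j, hj, hxj⟩ := Finset.mem_biUnion.1 hx
    obtain ⟨a, haj, haA⟩ := Finset.not_disjoint_iff.1 (Finset.mem_filter.1 hj).2.2
    exact ⟨a, haA, j, hxj, haj⟩

theorem exists_dist_le_of_mem_fattening (hR : ∀ j, j ∈ R j) {l₀ : ℕ}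
    (hl : ∀ j, diam G (R j) ≤ l₀) {A : Finset V} {x : V} (hx : x ∈ fattening Λ R A) :
    ∃ a ∈ A, G.dist x a ≤ l₀ := by
  obtain ⟨a, ha, j, hxj, haj⟩ := exists_of_mem_fattening hR hx
  exact ⟨a, ha, (dist_le_diam hxj haj).trans (hl j)⟩

theorem diam_fattening_le (hG : G.Connected) (hR : ∀ j, j ∈ R j) {l₀ : ℕ}
    (hl : ∀ j, diam G (R j) ≤ l₀) (A : Finset V) :
    diam G (fattening Λ R A) ≤ diam G A + 2 * l₀ := by
  refine diam_le fun x hx y hy => ?_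
  obtain ⟨a, ha, hxa⟩ := exists_dist_le_of_mem_fattening hR hl hx
  obtain ⟨b, hb, hyb⟩ := exists_dist_le_of_mem_fattening hR hl hy
  have h1 := hG.dist_triangle (u := x) (v := a) (w := y)
  have h2 := hG.dist_triangle (u := a) (v := b) (w := y)
  rw [SimpleGraph.dist_comm (u := b) (v := y)] at h2
  have h3 : G.dist a b ≤ diam G A := dist_le_diam ha hb
  omega

/-- The evolution by a commuting Hamiltonian enlarges supports by at most one layer of terms. -/
theorem expI_conj_mem_localAlgebra (hcomm : IsCommuting R h) {A : Finset V}
    {M : LocOp q Λ} (hM : M ∈ localAlgebra q Λ A) (r : ℝ) :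
    expI (siteHamiltonian Λ R h) r * M * expI (siteHamiltonian Λ R h) (-r) ∈
      localAlgebra q Λ (fattening Λ R A) := by
  -- The far terms commute with `M` and with the near terms, so their exponentials cancel from the
  -- conjugation.
  set near : LocOp q Λ := ∑ j ∈ Λ with ¬Disjoint (R j) A, siteTerm Λ R h j with hnear
  set far : LocOp q Λ := ∑ j ∈ Λ with Disjoint (R j) A, siteTerm Λ R h j with hfar
  have hsum : siteHamiltonian Λ R h = near + far := by
    rw [siteHamiltonian_eq_sum, add_comm]
    exact (Finset.sum_filter_add_sum_filter_not _ _ _).symm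
  have hnf : Commute near far :=
    Commute.sum_left _ _ _ fun j _ => Commute.sum_right _ _ _ fun j' _ => commute_siteTerm hcomm j j'
  have hfM : Commute far M := Commute.sum_left _ _ _ fun j hj =>
    commute_of_disjoint (Finset.mem_filter.1 hj).2
      (siteTerm_mem_localAlgebra j fun _ => Finset.Subset.refl _) hM
  have hmem : near ∈ localAlgebra q Λ (fattening Λ R A) := by
    refine sum_mem fun j hj => siteTerm_mem_localAlgebra j fun hjΛ => ?_
    have hj' := Finset.mem_filter.1 hj
    exact (Finset.subset_biUnion_of_mem R
      (Finset.mem_filter.2 ⟨hj'.1, hjΛ, hj'.2⟩)).trans Finset.subset_union_right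
  have heq : expI (siteHamiltonian Λ R h) r * M * expI (siteHamiltonian Λ R h) (-r) =
      expI near r * M * expI near (-r) := by
    have h1 : expI (near + far) (-r) = expI far (-r) * expI near (-r) := by
      rw [add_comm, expI_add_of_commute hnf.symm]
    rw [hsum, h1, expI_add_of_commute hnf]
    calc _ = expI near r * (expI far r * M) * expI far (-r) * expI near (-r) := by noncomm_ring
      _ = expI near r * M * (expI far r * expI far (-r)) * expI near (-r) := by
        rw [(commute_expI hfM r).eq]; noncomm_ring
      _ = _ := by rw [expI_mul_neg, mul_one]
  rw [heq]
  exact mul_mem (mul_mem (expI_mem_localAlgebra hmem r) (localAlgebra_mono (subset_fattening A) hM))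
    (expI_mem_localAlgebra hmem (-r))

/-- If `x` lies in the fattening of `A`, then `A` contains one of the at most `w` sites sharing a
region with `x`. The diameter growth `2 * l₀` produces the exponential factor. -/
theorem sum_fattening_le (hG : G.Connected) (hR : ∀ j, j ∈ R j) {l₀ w : ℕ}
    (hl : ∀ j, diam G (R j) ≤ l₀)
    (hw : ∀ j, {i : V | ∃ j', j ∈ R j' ∧ i ∈ R j'}.encard ≤ w) {μ : ℝ} (hμ : 0 ≤ μ)
    {W : Interaction q} (hW : interactionNorm G μ W ≠ ⊤) (x : V) :
    ∑ A ∈ Λ.powerset with x ∈ fattening Λ R A,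
        ‖W A‖ * Real.exp (μ * diam G (fattening Λ R A)) ≤
      w * Real.exp (2 * μ * l₀) * (interactionNorm G μ W).toReal := by
  have hfin := Set.finite_of_encard_le_coe (hw x)
  set S : Finset V := hfin.toFinset with hS
  have hcard : S.card ≤ w := by
    have := hw x
    rw [hfin.encard_eq_coe_toFinset_card] at this
    exact_mod_cast this
  have h1 : ∀ A : Finset V, ‖W A‖ * Real.exp (μ * diam G (fattening Λ R A)) ≤
      Real.exp (2 * μ * l₀) * (‖W A‖ * Real.exp (μ * diam G A)) := by
    intro A
    have hd : (diam G (fattening Λ R A) : ℝ) ≤ diam G A + 2 * l₀ := by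
      exact_mod_cast diam_fattening_le hG hR hl A
    have : Real.exp (μ * diam G (fattening Λ R A)) ≤
        Real.exp (2 * μ * l₀) * Real.exp (μ * diam G A) := by
      rw [← Real.exp_add]
      exact Real.exp_le_exp.2 (by nlinarith)
    calc _ ≤ ‖W A‖ * (Real.exp (2 * μ * l₀) * Real.exp (μ * diam G A)) := by gcongr
      _ = _ := by ring
  have hcover : ∑ A ∈ Λ.powerset with x ∈ fattening Λ R A, ‖W A‖ * Real.exp (μ * diam G A) ≤
      ∑ i ∈ S, ∑ A ∈ Λ.powerset with i ∈ A, ‖W A‖ * Real.exp (μ * diam G A) := by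
    simp only [Finset.sum_filter]
    rw [Finset.sum_comm]
    refine Finset.sum_le_sum fun A _ => ?_
    have hnonneg : ∀ i ∈ S, 0 ≤ if i ∈ A then ‖W A‖ * Real.exp (μ * diam G A) else 0 :=
      fun i _ => by split_ifs <;> positivity
    by_cases hA : x ∈ fattening Λ R A
    · obtain ⟨a, ha, j, hxj, haj⟩ := exists_of_mem_fattening hR hA
      rw [if_pos hA]
      exact (if_pos ha).ge.trans
        (Finset.single_le_sum hnonneg (hfin.mem_toFinset.2 ⟨j, hxj, haj⟩))
    · rw [if_neg hA]
      exact Finset.sum_nonneg hnonneg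
  have hsite : ∀ i, ∑ A ∈ Λ.powerset with i ∈ A, ‖W A‖ * Real.exp (μ * diam G A) ≤
      (interactionNorm G μ W).toReal := fun i =>
    sum_le_interactionNorm hW fun A hA => (Finset.mem_filter.1 hA).2
  calc _ ≤ ∑ A ∈ Λ.powerset with x ∈ fattening Λ R A,
          Real.exp (2 * μ * l₀) * (‖W A‖ * Real.exp (μ * diam G A)) :=
        Finset.sum_le_sum fun A _ => h1 A
    _ = Real.exp (2 * μ * l₀) * ∑ A ∈ Λ.powerset with x ∈ fattening Λ R A,
          ‖W A‖ * Real.exp (μ * diam G A) := by rw [Finset.mul_sum]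
    _ ≤ Real.exp (2 * μ * l₀) * ∑ i ∈ S, ∑ A ∈ Λ.powerset with i ∈ A,
          ‖W A‖ * Real.exp (μ * diam G A) := by
        exact mul_le_mul_of_nonneg_left hcover (Real.exp_pos _).le
    _ ≤ Real.exp (2 * μ * l₀) * (w * (interactionNorm G μ W).toReal) := by
        gcongr
        refine (Finset.sum_le_card_nsmul _ _ _ fun i _ => hsite i).trans ?_
        rw [nsmul_eq_mul]
        gcongr
    _ = _ := by ring

theorem norm_lie_heisenberg_le_card_left (hG : G.Connected) {d : ℕ} {C : ℝ}
    (hC : ∀ A : Finset V, (A.card : ℝ) ≤ C * ((diam G A : ℝ) + 1) ^ d)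
    (hR : ∀ j, j ∈ R j) (hh : ∀ j, (h j).IsHermitian) (hcomm : IsCommuting R h) {l₀ w : ℕ}
    (hl : ∀ j, diam G (R j) ≤ l₀)
    (hw : ∀ j, {i : V | ∃ j', j ∈ R j' ∧ i ∈ R j'}.encard ≤ w) {W : Interaction q}
    (hWh : ∀ A, (W A).IsHermitian) {κ η : ℝ} (hκ : 0 < κ) (hη : 0 < η)
    (hW : interactionNorm G (κ + η) W ≠ ⊤) {X Y : Finset V} (hX : X ⊆ Λ) (hY : Y ⊆ Λ)
    (OX : LocOp q X) (OY : LocOp q Y) {t : ℝ} (ht : 0 ≤ t) :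
    ‖⁅heisenberg (siteHamiltonian Λ R h + hamiltonian Λ W) (extend hX OX) t, extend hY OY⁆‖ ≤
      2 * Real.exp (κ * l₀) * X.card * ‖OX‖ * ‖OY‖ *
        Real.exp (-κ * ((setDist G X Y : ℝ) -
          2 * w * C * Real.exp η / κ * (d / (Real.exp 1 * η)) ^ d *
            Real.exp (2 * (κ + η) * l₀) * (interactionNorm G (κ + η) W).toReal * t)) := by
  have hC0 : 0 ≤ C := by simpa [diam] using hC ∅
  set H₀ : LocOp q Λ := siteHamiltonian Λ R h with hH₀
  set H₁ : LocOp q Λ := hamiltonian Λ W with hH₁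
  have hsa₀ : IsSelfAdjoint H₀ := isSelfAdjoint_siteHamiltonian hh
  have hsa₁ : IsSelfAdjoint H₁ := isSelfAdjoint_hamiltonian Λ hWh
  set N : ℝ := w * Real.exp (2 * (κ + η) * l₀) * (interactionNorm G (κ + η) W).toReal with hN
  have hN0 : 0 ≤ N := by positivity
  set v : ℝ := 2 * C * Real.exp η * (d / (Real.exp 1 * η)) ^ d with hv
  have hv0 : 0 ≤ v := by positivity
  set B : {A : Finset V // A ∈ Λ.powerset} → Finset V := fun A => fattening Λ R A.1 with hB
  set K : {A : Finset V // A ∈ Λ.powerset} → ℝ → LocOp q Λ := fun A s =>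
    expI H₀ (s - t) * extend (Finset.mem_powerset.1 A.2) (W A.1) * expI H₀ (-(s - t)) with hK
  -- Shifting the time by `t` puts the free evolution on `OY`. Thus `OX` keeps its support and the
  -- prefactor `X.card`, while fattening `Y` costs only `exp (κ l₀)`.
  set U : ℝ → LocOp q Λ := fun s => expI H₀ (s - t) * expI (H₀ + H₁) (-s) * expI H₀ t with hU
  have hstar : ∀ r, star (expI H₀ r) = expI H₀ (-r) := star_expI hsa₀
  have hev : IsLocalEvolution B K U 0 := by
    refine ⟨fun A => fattening_subset (Finset.mem_powerset.1 A.2), fun A s => ?_, fun A s => ?_,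
      ?_, fun s => ?_⟩
    · have hc := (isSelfAdjoint_extend (Finset.mem_powerset.1 A.2) (hWh A.1)).conjugate
        (expI H₀ (s - t))
      rwa [hstar] at hc
    · exact expI_conj_mem_localAlgebra hcomm
        (extend_mem_localAlgebra _ (Finset.Subset.refl _) _) _
    · simp only [hU, neg_zero, expI_zero, mul_one, zero_sub, expI_neg_mul]
    · have hsum : ∑ A, K A s = expI H₀ (s - t) * H₁ * expI H₀ (-(s - t)) := by
        rw [hH₁, hamiltonian, Finset.mul_sum, Finset.sum_mul]
      rw [hsum]
      exact hasDerivAt_interactionPicture H₀ H₁ t s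
  have hKn : ∀ A s, ‖K A s‖ ≤ ‖W A.1‖ := by
    intro A s
    rw [hK]
    dsimp only
    rw [CStarRing.norm_mul_mem_unitary _ (expI_mem_unitary hsa₀ _),
      CStarRing.norm_mem_unitary_mul _ (expI_mem_unitary hsa₀ _)]
    exact norm_extend_le _ _
  -- Sites of the fattened `Y` are within `l₀` of `Y`, so the factor `exp (κ l₀)` lifts their weight
  -- to at least one.
  have hdom : IsLocalEvolution.IsDominated B K
      (fun x => Real.exp (κ * l₀) * siteWeight G κ Y x) fun _ => v * N := by
    refine isDominated_siteWeight hG hC hκ hη Y (Real.exp_pos _).le (N := fun _ => N) fun x _ s => ?_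
    refine le_trans ?_ (sum_fattening_le (Λ := Λ) hG hR hl hw (by positivity) hW x)
    rw [Finset.sum_filter, Finset.sum_filter, ← Finset.sum_coe_sort Λ.powerset]
    refine Finset.sum_le_sum fun A _ => ?_
    by_cases hx : x ∈ fattening Λ R A.1
    · rw [if_pos hx, if_pos hx]
      exact mul_le_mul_of_nonneg_right (hKn A s) (Real.exp_pos _).le
    · rw [if_neg hx, if_neg hx]
  have hmain := hev.norm_lie_le
    (fun x => mul_pos (Real.exp_pos _) (siteWeight_pos κ Y x)) hdom measurable_const
    (fun _ => mul_nonneg hv0 hN0) (fun _ => le_rfl) (Y := fattening Λ R Y)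
    (fun y hy => by
      obtain ⟨a, ha, hya⟩ := exists_dist_le_of_mem_fattening (G := G) hR hl hy
      exact exp_mul_siteWeight_ge_one hκ ha hya)
    (expI_conj_mem_localAlgebra hcomm (extend_mem_localAlgebra hY (Finset.Subset.refl Y) OY)
      (-t)) hX (extend_mem_localAlgebra hX (Finset.Subset.refl X) OX) ht
  have hF : expI H₀ t ∈ unitary (LocOp q Λ) := expI_mem_unitary hsa₀ t
  have hUt : U t = expI (H₀ + H₁) (-t) * expI H₀ t := by
    rw [hU]
    dsimp only
    rw [sub_self, expI_zero, one_mul]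
  -- At the final time the interaction-picture commutator is a unitary conjugate of the Heisenberg
  -- one.
  have hlhs : ⁅star (U t) * extend hX OX * U t,
      expI H₀ (-t) * extend hY OY * expI H₀ (- -t)⁆ =
      star (expI H₀ t) * ⁅heisenberg (H₀ + H₁) (extend hX OX) t, extend hY OY⁆ * expI H₀ t := by
    have e1 : star (U t) * extend hX OX * U t =
        star (expI H₀ t) * heisenberg (H₀ + H₁) (extend hX OX) t * expI H₀ t := by
      rw [hUt, star_mul, star_expI (hsa₀.add hsa₁), neg_neg, heisenberg_eq]
      noncomm_ring
    have e2 : ∀ x y : LocOp q Λ,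
        star (expI H₀ t) * x * expI H₀ t * (star (expI H₀ t) * y * expI H₀ t) =
          star (expI H₀ t) * (x * y) * expI H₀ t := by
      intro x y
      calc _ = star (expI H₀ t) * x * (expI H₀ t * star (expI H₀ t)) * y * expI H₀ t := by
            noncomm_ring
        _ = _ := by rw [(Unitary.mem_iff.1 hF).2]; noncomm_ring
    rw [e1, neg_neg, ← hstar t, Ring.lie_def, Ring.lie_def, e2, e2, mul_sub, sub_mul]
  rw [hlhs, norm_star_mul_mul hF] at hmain
  refine hmain.trans ?_
  have h1 := norm_extend_le hX OX
  have h2 : ‖expI H₀ (-t) * extend hY OY * expI H₀ (- -t)‖ ≤ ‖OY‖ := by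
    rw [CStarRing.norm_mul_mem_unitary _ (expI_mem_unitary hsa₀ _),
      CStarRing.norm_mem_unitary_mul _ (expI_mem_unitary hsa₀ _)]
    exact norm_extend_le _ _
  have h3 := sum_siteWeight_le (G := G) hκ X Y
  have h0 : 0 ≤ ∑ x ∈ X, siteWeight G κ Y x :=
    Finset.sum_nonneg fun x _ => (siteWeight_pos κ Y x).le
  rw [← Finset.mul_sum, intervalIntegral.integral_const, sub_zero, smul_eq_mul]
  calc _ ≤ 2 * ‖OX‖ * ‖OY‖ *
        (Real.exp (κ * l₀) * (X.card * Real.exp (-κ * (setDist G X Y : ℝ)))) *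
        Real.exp (t * (v * N)) := by gcongr
    _ = 2 * Real.exp (κ * l₀) * X.card * ‖OX‖ * ‖OY‖ *
        (Real.exp (-κ * (setDist G X Y : ℝ)) * Real.exp (t * (v * N))) := by ring
    _ = _ := by
      rw [← Real.exp_add]
      congr 2
      rw [hv, hN]
      field_simp
      ring

/-- Unitary conjugation moves the evolution to the other operator and reverses time; `-H` is again a
commuting part plus a perturbation, with the same geometry and norm. -/
theorem norm_lie_heisenberg_neg (H O P : LocOp q Λ) (hH : IsSelfAdjoint H) (t : ℝ) :
    ‖⁅heisenberg H O t, P⁆‖ = ‖⁅heisenberg (-H) P t, O⁆‖ := by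
  have h1 := norm_lie_conj (expI_mem_unitary hH (-t)) O P
  rw [star_expI hH, neg_neg] at h1
  rw [heisenberg_eq, heisenberg_eq, neg_expI, neg_expI, neg_neg]
  exact h1

theorem norm_lie_heisenberg_le (hG : G.Connected) {d : ℕ} {C : ℝ}
    (hC : ∀ A : Finset V, (A.card : ℝ) ≤ C * ((diam G A : ℝ) + 1) ^ d)
    (hR : ∀ j, j ∈ R j) (hh : ∀ j, (h j).IsHermitian) (hcomm : IsCommuting R h) {l₀ w : ℕ}
    (hl : ∀ j, diam G (R j) ≤ l₀)
    (hw : ∀ j, {i : V | ∃ j', j ∈ R j' ∧ i ∈ R j'}.encard ≤ w) {W : Interaction q}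
    (hWh : ∀ A, (W A).IsHermitian) {κ η : ℝ} (hκ : 0 < κ) (hη : 0 < η)
    (hW : interactionNorm G (κ + η) W ≠ ⊤) {X Y : Finset V} (hX : X ⊆ Λ) (hY : Y ⊆ Λ)
    (OX : LocOp q X) (OY : LocOp q Y) {t : ℝ} (ht : 0 ≤ t) :
    ‖⁅heisenberg (siteHamiltonian Λ R h + hamiltonian Λ W) (extend hX OX) t, extend hY OY⁆‖ ≤
      2 * Real.exp (κ * l₀) * (min X.card Y.card : ℕ) * ‖OX‖ * ‖OY‖ *
        Real.exp (-κ * ((setDist G X Y : ℝ) -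
          2 * w * C * Real.exp η / κ * (d / (Real.exp 1 * η)) ^ d *
            Real.exp (2 * (κ + η) * l₀) * (interactionNorm G (κ + η) W).toReal * t)) := by
  rcases le_total X.card Y.card with hXY | hXY
  · rw [min_eq_left hXY]
    exact norm_lie_heisenberg_le_card_left hG hC hR hh hcomm hl hw hWh hκ hη hW hX hY OX OY ht
  · rw [min_eq_right hXY, norm_lie_heisenberg_neg _ _ _
      ((isSelfAdjoint_siteHamiltonian hh).add (isSelfAdjoint_hamiltonian Λ hWh)), neg_add,
      ← siteHamiltonian_neg, ← hamiltonian_neg]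
    have hneg := norm_lie_heisenberg_le_card_left hG hC hR (fun j => (hh j).neg)
      (isCommuting_neg hcomm) hl hw (W := fun A => -W A) (fun A => (hWh A).neg) hκ hη
      (by rwa [interactionNorm_neg]) hY hX OY OX ht
    rw [interactionNorm_neg, setDist_comm] at hneg
    exact hneg.trans_eq (by ring)

end SiteTerm

end CommutingPerturbation

end LiebRobinson

end

open LiebRobinson in
theorem theorem2 {V : Type*} [DecidableEq V] (G : SimpleGraph V) (hG : G.Connected)
    (q : V → ℕ) [∀ x, NeZero (q x)] (d : ℕ) (C : ℝ)
    (hC : ∀ A : Finset V, (A.card : ℝ) ≤ C * ((diam G A : ℝ) + 1) ^ d) :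
    -- the bound for a time-dependent quasi-local Hamiltonian
    (∀ (H : ℝ → Interaction q) (μstar : ℝ),
      (∀ t A, (H t A).IsHermitian) →
      (∀ A, MeasureTheory.StronglyMeasurable fun t => H t A) →
      (∀ μ < μstar, ∃ K : NNReal, ∀ t, interactionNorm G μ (H t) ≤ K) →
      ∀ κ η : ℝ, 0 < κ → 0 < η → κ + η < μstar →
      ∀ (Λ : Finset V) (U : ℝ → ℝ → LocOp q Λ),
      IsPropagator (fun t => hamiltonian Λ (H t)) U →
      ∀ (X Y : Finset V) (hX : X ⊆ Λ) (hY : Y ⊆ Λ) (OX : LocOp q X) (OY : LocOp q Y) (t' t : ℝ),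
      t' ≤ t →
      ‖⁅star (U t t') * extend hX OX * U t t', extend hY OY⁆‖ ≤
        2 * (min X.card Y.card : ℕ) * ‖OX‖ * ‖OY‖ *
          Real.exp (-κ * ((setDist G X Y : ℝ) -
            2 * C * Real.exp η / κ * (d / (Real.exp 1 * η)) ^ d *
              ∫ s in t'..t, (interactionNorm G (κ + η) (H s)).toReal))) ∧
    -- its consequence for `H = H₀ + W` with `H₀` a commuting local Hamiltonian
    (∀ (R : V → Finset V) (h : (j : V) → LocOp q (R j)) (l₀ w : ℕ) (W : Interaction q),
      (∀ j, j ∈ R j) →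
      (∀ j, (h j).IsHermitian) →
      IsCommuting R h →
      (∀ j, diam G (R j) ≤ l₀) →
      (∀ j, {i : V | ∃ j', j ∈ R j' ∧ i ∈ R j'}.encard ≤ w) →
      (∀ A, (W A).IsHermitian) →
      ∀ κ η : ℝ, 0 < κ → 0 < η → interactionNorm G (κ + η) W ≠ ⊤ →
      ∀ (Λ X Y : Finset V) (hX : X ⊆ Λ) (hY : Y ⊆ Λ) (OX : LocOp q X) (OY : LocOp q Y) (t : ℝ),
      0 ≤ t →
      ‖⁅heisenberg (siteHamiltonian Λ R h + hamiltonian Λ W) (extend hX OX) t, extend hY OY⁆‖ ≤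
        2 * Real.exp (κ * l₀) * (min X.card Y.card : ℕ) * ‖OX‖ * ‖OY‖ *
          Real.exp (-κ * ((setDist G X Y : ℝ) -
            2 * w * C * Real.exp η / κ * (d / (Real.exp 1 * η)) ^ d *
              Real.exp (2 * (κ + η) * l₀) * (interactionNorm G (κ + η) W).toReal * t))) := by
  constructor
  · intro H μstar hH hHm hbd κ η hκ hη hμ Λ U hU X Y hX hY OX OY t' t ht
    obtain ⟨c, hc⟩ := hbd _ hμ
    exact lieb_robinson hG hC hH hHm hκ hη hc hU hX hY OX OY ht
  · intro R h l₀ w W hR hh hcomm hl hw hWh κ η hκ hη hW Λ X Y hX hY OX OY t ht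
    exact norm_lie_heisenberg_le hG hC hR hh hcomm hl hw hWh hκ hη hW hX hY OX OY ht
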